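/- Let $\mathbb{D}=\{z\in\mathbb{C}:|z|<1\}$, with the hyperbolic distance $\operatorname{dist}_{\mathrm{hyp}}$ of the metric $\frac{2|dz|}{1-|z|^2}$ (curvature $-1$). For a simply connected region $D\subsetneq\mathbb{C}$ and $z\in D$ the conformal radius is $\operatorname{crad}(D,z)=|f'(0)|$, where $f$ is a conformal map of $\mathbb{D}$ onto $D$ with $f(0)=z$. For $B\subset\mathbb{D}\setminus\{0\}$ with $\mathbb{D}\setminus B$ a simply connected region put $$\operatorname{dcap}(B)=-\log\operatorname{crad}(\mathbb{D}\setminus B,0).$$ For $B\subset\mathbb{D}$ let $N(B)=\{z\in\mathbb{D}:\operatorname{dist}_{\mathrm{hyp}}(z,B)\le 1\}$ (with $\operatorname{dist}_{\mathrm{hyp}}(z,\emptyset)=\infty$), and let $\widehat N(B)$ be the union of $N(B)$ and of all connected components of $\mathbb{D}\setminus N(B)$ that do not contain $0$. There is an absolute constant $C>0$ such that for every set $B\subset\{z:\frac12<|z|<1\}$ for which $\mathbb{D}\setminus B$ is a simply connected region, the set $\mathbb{D}\setminus\widehat N(B)$ is a simply connected region containing $0$, and $$\operatorname{dcap}\widehat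 N(B)\le C\,\operatorname{dcap}(B).$$ -/

import Mathlib

namespace DiscCapacity

noncomputable section

/-- The open unit disc `𝔻` of the complex plane. -/
abbrev disc : Set ℂ := Metric.ball 0 1

/-- A simply connected region: an open, (path-)connected, nonempty set all of whose loops are
null-homotopic. -/
def IsSimplyConnectedRegion (D : Set ℂ) : Prop := IsOpen D ∧ IsSimplyConnected D

/-- `f` is a conformal map of the unit disc onto `D` with `f 0 = z`: a holomorphic bijection
`𝔻 → D` with holomorphic inverse. -/
def IsConformalFromDisc (f : ℂ → ℂ) (D : Set ℂ) (z : ℂ) : Prop :=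
  DifferentiableOn ℂ f disc ∧ Set.BijOn f disc D ∧
    (∃ g : ℂ → ℂ, DifferentiableOn ℂ g D ∧ Set.InvOn g f disc D) ∧ f 0 = z

open Classical in
/-- The conformal radius `|f'(0)|` of `D` with respect to `z`, where `f` is any conformal map of
the unit disc onto `D` with `f 0 = z` (by the Riemann mapping theorem there is one whenever
`D ≠ ℂ` is a simply connected region that contains `z`; the value does not depend on it, see
`crad_eq`). -/
def crad (D : Set ℂ) (z : ℂ) : ℝ :=
  if h : ∃ f : ℂ → ℂ, IsConformalFromDisc f D z then ‖deriv h.choose 0‖ else 0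

theorem norm_deriv_le {f₁ f₂ : ℂ → ℂ} {D : Set ℂ} {z : ℂ}
    (h₁ : IsConformalFromDisc f₁ D z) (h₂ : IsConformalFromDisc f₂ D z) :
    ‖deriv f₁ 0‖ ≤ ‖deriv f₂ 0‖ := by
  obtain ⟨d₁, b₁, -, z₁⟩ := h₁
  obtain ⟨d₂, b₂, ⟨g, dg, hl, hr⟩, z₂⟩ := h₂
  have mem0 : (0 : ℂ) ∈ disc := by simp
  have hmaps : Set.MapsTo g D disc := fun w hw => by
    obtain ⟨x, hx, rfl⟩ := b₂.surjOn hw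
    rwa [hl hx]
  have hd : DifferentiableOn ℂ (g ∘ f₁) disc := dg.comp d₁ b₁.mapsTo
  have h0 : (g ∘ f₁) 0 = 0 := by
    have := hl mem0
    simpa [z₁, z₂] using this
  have hS : ‖deriv (g ∘ f₁) 0‖ ≤ 1 := by
    apply Complex.norm_deriv_le_one_of_mapsTo_ball hd ?_ one_pos
    rw [h0]
    exact (hmaps.comp b₁.mapsTo).mono_right Metric.ball_subset_closedBall
  have hnhds : disc ∈ nhds (0 : ℂ) := Metric.isOpen_ball.mem_nhds mem0
  have hEq : f₁ =ᶠ[nhds 0] f₂ ∘ (g ∘ f₁) := by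
    filter_upwards [hnhds] with x hx
    exact (hr (b₁.mapsTo hx)).symm
  have hf₂ : DifferentiableAt ℂ f₂ ((g ∘ f₁) 0) := by
    rw [h0]; exact d₂.differentiableAt hnhds
  rw [hEq.deriv_eq, deriv_comp 0 hf₂ (hd.differentiableAt hnhds), h0, norm_mul]
  exact mul_le_of_le_one_right (norm_nonneg _) hS

/-- The conformal radius is the derivative at `0` of any conformal map. -/
theorem crad_eq {f : ℂ → ℂ} {D : Set ℂ} {z : ℂ} (hf : IsConformalFromDisc f D z) :
    crad D z = ‖deriv f 0‖ := by
  have h : ∃ f : ℂ → ℂ, IsConformalFromDisc f D z := ⟨f, hf⟩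
  rw [crad, dif_pos h]
  exact le_antisymm (norm_deriv_le h.choose_spec hf) (norm_deriv_le hf h.choose_spec)

/-- `dcap B = -log crad (𝔻 \ B, 0)`. -/
def dcap (B : Set ℂ) : ℝ := -Real.log (crad (disc \ B) 0)

/-- The hyperbolic distance of two points of the unit disc, for the metric
`2 |dz| / (1 - |z|²)` of curvature `-1`. -/
def hypDist (z w : ℂ) : ℝ :=
  2 * Real.arsinh (‖z - w‖ / √((1 - ‖z‖ ^ 2) * (1 - ‖w‖ ^ 2)))

/-- The hyperbolic distance of a point to a set (`∞` for the empty set). -/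
def hypInfDist (z : ℂ) (B : Set ℂ) : ENNReal := ⨅ b ∈ B, ENNReal.ofReal (hypDist z b)

/-- The closed hyperbolic neighbourhood `N(B)` of radius one. -/
def hypNhd (B : Set ℂ) : Set ℂ := {z | z ∈ disc ∧ hypInfDist z B ≤ 1}

/-- `N(B)` together with all the connected components of `𝔻 \ N(B)` that do not contain `0`. -/
def filledHypNhd (B : Set ℂ) : Set ℂ :=
  hypNhd B ∪ ⋃₀ {K | (∃ z ∈ disc \ hypNhd B, K = connectedComponentIn (disc \ hypNhd B) z) ∧ 0 ∉ K}

end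

end DiscCapacity

/-! Write U = 𝔻 ∖ B and D = 𝔻 ∖ N̂(B), with Riemann maps φ, ψ fixing 0 and inverses f, g. The
function log |f(z)/z| is nonnegative and harmonic on U with value dcap B at 0; log |g(z)/z| plays
the same role for D, with boundary values log (1/|z|). So it is enough to dominate log (1/|z|) by n
log |f(z)/z| on ∂D. Concretely, the maximum principle is applied on D to q(z) = (g(z)/z)(z/f(z))^n
(`norm_deriv_pow_le`), and |q(0)| ≤ 1 compares the two conformal radii.

A boundary point z = φ(v) of D inside 𝔻 lies within hyperbolic distance 1 of some b ∈ B, a value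
that φ omits. Move b to 0 by an automorphism and take a square root s. Then φ(v) = `mob (s 0) (s v)
* mob (-s 0) (s v)`: the Schwarz lemma bounds the first factor by |v|, and closeness to b keeps s v
in a fixed smaller disc, which makes the second factor smaller than 1 by a definite share of 1 -
|v|². Since |b| > 1/2 keeps |z| away from 0, a fixed power of |z|/|v| is at most |z|
(`norm_div_pow_le`).

For the topology, simple connectivity is exchanged for the existence of continuous logarithms
(`HasContLog`). Logarithms on U force its complement to be connected, and attaching convex
hyperbolic discs centred on B leaves E = N(B) ∪ {|z| ≥ 1} connected. As D is a component of the
complement of the unbounded connected set E, no compact subset of D cuts a point outside D from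
infinity; by Eilenberg's theorem D has logarithms. Koebe's proof of the Riemann mapping theorem
needs only these, and the resulting map makes D homeomorphic to the disc. -/

namespace DiscCapacity

open Set Filter Topology Metric
open scoped ComplexConjugate

/-! ### Continuous logarithms, simple connectivity and holomorphic square roots. -/

/-- Every nonvanishing continuous function on `D` has a continuous logarithm. -/
def HasContLog (D : Set ℂ) : Prop :=
  ∀ g : ℂ → ℂ, ContinuousOn g D → (∀ z ∈ D, g z ≠ 0) →
    ∃ f : ℂ → ℂ, ContinuousOn f D ∧ ∀ z ∈ D, Complex.exp (f z) = g z

theorem IsSimplyConnectedRegion.hasContLog {D : Set ℂ} (h : IsSimplyConnectedRegion D) :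
    HasContLog D := by
  intro g hg h0
  obtain ⟨f, hf, hfg⟩ := Complex.exists_continuousOn_eqOn_exp_comp h.2 h.1 hg
    (by rintro ⟨z, hz, hz0⟩; exact h0 z hz hz0)
  exact ⟨f, hf, hfg⟩

theorem isSimplyConnectedRegion_of_convex {D : Set ℂ} (ho : IsOpen D) (hc : Convex ℝ D)
    (hn : D.Nonempty) : IsSimplyConnectedRegion D := by
  refine ⟨ho, ?_⟩
  have := hc.contractibleSpace hn
  exact SimplyConnectedSpace.ofContractible D

theorem isSimplyConnectedRegion_disc : IsSimplyConnectedRegion disc :=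
  isSimplyConnectedRegion_of_convex isOpen_ball (convex_ball _ _) ⟨0, by simp⟩

/-- A conformal map is a homeomorphism from the contractible disc; this is the way back from
logarithms to simple connectivity. -/
theorem IsConformalFromDisc.isSimplyConnectedRegion {f : ℂ → ℂ} {D : Set ℂ} {z : ℂ}
    (h : IsConformalFromDisc f D z) (ho : IsOpen D) : IsSimplyConnectedRegion D := by
  obtain ⟨df, bf, ⟨g, dg, hl, hr⟩, -⟩ := h
  have hg : MapsTo g D disc := fun w hw => by
    obtain ⟨x, hx, rfl⟩ := bf.surjOn hw
    rwa [hl hx]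
  let e : D ≃ₜ disc :=
    { toFun := fun w => ⟨g w, hg w.2⟩
      invFun := fun w => ⟨f w, bf.mapsTo w.2⟩
      left_inv := fun w => Subtype.ext (hr w.2)
      right_inv := fun w => Subtype.ext (hl w.2)
      continuous_toFun :=
        (continuousOn_iff_continuous_domRestrict.1 dg.continuousOn).subtype_mk _
      continuous_invFun :=
        (continuousOn_iff_continuous_domRestrict.1 df.continuousOn).subtype_mk _ }
  have : SimplyConnectedSpace disc := isSimplyConnectedRegion_disc.2
  exact ⟨ho, e.toHomotopyEquiv.simplyConnectedSpace⟩

/-- A continuous square root of a holomorphic nonvanishing function is holomorphic. -/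
theorem hasDerivAt_of_sq {s m : ℂ → ℂ} {m' z : ℂ} (hs : ContinuousAt s z)
    (hm : HasDerivAt m m' z) (hsq : ∀ᶠ w in 𝓝 z, s w ^ 2 = m w) (h0 : s z ≠ 0) :
    HasDerivAt s (m' / (2 * s z)) z := by
  rw [hasDerivAt_iff_tendsto_slope] at hm ⊢
  have hadd : Tendsto (fun w => s w + s z) (𝓝[≠] z) (𝓝 (2 * s z)) := by
    rw [two_mul]
    exact (hs.tendsto.mono_left nhdsWithin_le_nhds).add tendsto_const_nhds
  have h2 : (2 * s z) ≠ 0 := by simpa using h0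
  refine (hm.div hadd h2).congr' ?_
  filter_upwards [hadd.eventually_ne h2, hsq.filter_mono nhdsWithin_le_nhds] with w hw hws
  have hz := hsq.self_of_nhds
  rw [Pi.div_apply, slope_def_field, slope_def_field, ← hws, ← hz, div_right_comm]
  congr 1
  field_simp
  ring

theorem HasContLog.exists_sqrt {D : Set ℂ} (hD : HasContLog D) (ho : IsOpen D) {m : ℂ → ℂ}
    (hm : DifferentiableOn ℂ m D) (h0 : ∀ z ∈ D, m z ≠ 0) :
    ∃ s : ℂ → ℂ, DifferentiableOn ℂ s D ∧ ∀ z ∈ D, s z ^ 2 = m z := by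
  obtain ⟨f, hf, hfm⟩ := hD m hm.continuousOn h0
  have hsq : ∀ z ∈ D, Complex.exp (f z / 2) ^ 2 = m z := fun z hz => by
    rw [← Complex.exp_nat_mul, ← hfm z hz]
    congr 1
    push_cast
    ring
  refine ⟨fun z => Complex.exp (f z / 2), fun z hz => ?_, hsq⟩
  have hnz := ho.mem_nhds hz
  refine (hasDerivAt_of_sq (s := fun z => Complex.exp (f z / 2)) (m := m) ?_ (hm.differentiableAt hnz).hasDerivAt ?_
    (Complex.exp_ne_zero _)).differentiableAt.differentiableWithinAt
  · exact (Complex.continuous_exp.continuousAt).comp ((hf.continuousAt hnz).div_const 2)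
  · filter_upwards [hnz] with w hw using hsq w hw

/-! ### Hurwitz's theorem, and normal families along an ultrafilter. -/

theorem exists_zero_of_tendstoLocallyUniformlyOn {ι : Type*} {p : Filter ι}
    {F : ι → ℂ → ℂ} {f : ℂ → ℂ} {D V : Set ℂ} {z : ℂ} (hD : IsOpen D)
    (hF : ∀ i, DifferentiableOn ℂ (F i) D) (hlim : TendstoLocallyUniformlyOn F f p D)
    (hfc : ContinuousOn f D) (hz : z ∈ D) (h0 : f z = 0) (hne : ∀ᶠ w in 𝓝[≠] z, f w ≠ 0)
    (hV : V ∈ 𝓝 z) : ∀ᶠ i in p, ∃ w ∈ V, F i w = 0 := by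
  rw [eventually_nhdsWithin_iff] at hne
  obtain ⟨r, hr, hrs⟩ := nhds_basis_closedBall.mem_iff.1
    (inter_mem (inter_mem (hD.mem_nhds hz) hV) hne)
  have hrD : closedBall z r ⊆ D := fun w hw => (hrs hw).1.1
  have hsc : sphere z r ⊆ closedBall z r := sphere_subset_closedBall
  obtain ⟨w₀, hw₀, hmin⟩ := (isCompact_sphere z r).exists_isMinOn
    (NormedSpace.sphere_nonempty.2 hr.le) ((hfc.mono (hsc.trans hrD)).norm)
  have hε : 0 < ‖f w₀‖ := norm_pos_iff.2 <| (hrs (hsc hw₀)).2 <| by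
    rintro rfl
    simp [hr.ne] at hw₀
  set ε := ‖f w₀‖
  have hu := (tendstoLocallyUniformlyOn_iff_forall_isCompact hD).1 hlim _ hrD
    (isCompact_closedBall z r)
  filter_upwards [Metric.tendstoUniformlyOn_iff.1 hu (ε / 8) (by positivity)] with i hi
  have hiz := hi z (mem_closedBall_self hr.le)
  rw [h0, dist_zero_left] at hiz
  have hsph : ∀ w ∈ sphere z r, ε / 2 ≤ ‖F i w - F i z‖ := fun w hw => by
    have h1 := hi w (hsc hw)
    have h2 : ε ≤ ‖f w‖ := hmin hw
    rw [dist_eq_norm] at h1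
    have h3 := norm_sub_norm_le (f w) (f w - F i w)
    have h4 := norm_sub_norm_le (F i w) (F i z)
    rw [sub_sub_cancel] at h3
    linarith
  have hcd : DiffContOnCl ℂ (F i) (ball z r) :=
    DifferentiableOn.diffContOnCl ((hF i).mono (closure_ball_subset_closedBall.trans hrD))
  have hfreq : ∃ᶠ w in 𝓝 z, F i w ≠ F i z := by
    intro hcon
    simp only [not_not] at hcon
    have han : AnalyticOnNhd ℂ (F i) (closedBall z r) :=
      ((hF i).analyticOnNhd hD).mono hrD
    have := han.eqOn_of_preconnected_of_eventuallyEq (analyticOnNhd_const (v := F i z))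
      (convex_closedBall z r).isPreconnected (mem_closedBall_self hr.le) hcon
    have h5 := hsph w₀ hw₀
    rw [this (hsc hw₀), sub_self, norm_zero] at h5
    linarith
  -- Quantitative open mapping: `F i` differs from `F i z` by at least ε/2 on the circle, so its
  -- image contains the ε/4-ball about `F i z`, hence 0, because `‖F i z‖ < ε / 8`.
  have := hcd.ball_subset_image_closedBall hr hsph hfreq
  obtain ⟨w, hw, hw0⟩ := this (show (0 : ℂ) ∈ ball (F i z) (ε / 2 / 2) by
    rw [mem_ball, dist_zero_left]; linarith)
  exact ⟨w, (hrs hw).1.2, hw0⟩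

/-- A family of holomorphic maps into the unit disc converges locally uniformly along any
ultrafilter. -/
theorem exists_tendstoLocallyUniformlyOn {ι : Type*} (p : Ultrafilter ι)
    {F : ι → ℂ → ℂ} {D : Set ℂ} (hD : IsOpen D) (hF : ∀ i, DifferentiableOn ℂ (F i) D)
    (hm : ∀ i, MapsTo (F i) D disc) :
    ∃ f : ℂ → ℂ, TendstoLocallyUniformlyOn F f p D ∧ MapsTo f D (closedBall 0 1) := by
  have hex : ∀ z : ℂ, ∃ w : ℂ, z ∈ D → w ∈ closedBall (0 : ℂ) 1 ∧
      Tendsto (fun i => F i z) p (𝓝 w) := fun z => by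
    by_cases hz : z ∈ D
    · obtain ⟨w, hw, hle⟩ := (isCompact_closedBall (0 : ℂ) 1).ultrafilter_le_nhds
        (p.map fun i => F i z) (by
          rw [le_principal_iff]
          exact (Eventually.of_forall fun i => ball_subset_closedBall (hm i hz) :
            ∀ᶠ i in (p : Filter ι), F i z ∈ closedBall (0 : ℂ) 1))
      exact ⟨w, fun _ => ⟨hw, hle⟩⟩
    · exact ⟨0, fun h => absurd h hz⟩
  choose f hf using hex
  refine ⟨f, ?_, fun z hz => (hf z hz).1⟩
  rw [hD.tendstoLocallyUniformlyOn_iff_forall_tendsto]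
  intro x hx
  obtain ⟨R, hR, hRD⟩ := Metric.isOpen_iff.1 hD x hx
  -- Equicontinuity from the Schwarz lemma, two values of `F i` being less than 2 apart; it upgrades
  -- the pointwise ultrafilter limits to locally uniform ones.
  have hlip : ∀ i, ∀ y ∈ ball x R, dist (F i y) (F i x) ≤ 2 / R * dist y x := fun i y hy => by
    refine Complex.dist_le_div_mul_dist_of_mapsTo_ball ((hF i).mono hRD) (fun w hw => ?_) hy
    have h1 := hm i (hRD hw)
    have h2 := hm i hx
    rw [mem_ball_zero_iff] at h1 h2
    rw [mem_closedBall, dist_eq_norm]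
    linarith [norm_sub_le (F i w) (F i x)]
  have hlipf : ∀ y ∈ ball x R, dist (f y) (f x) ≤ 2 / R * dist y x := fun y hy =>
    le_of_tendsto ((hf y (hRD hy)).2.dist (hf x hx).2) (Eventually.of_forall fun i => hlip i y hy)
  rw [Metric.uniformity_basis_dist.tendsto_right_iff]
  intro ε hε
  have h1 : ∀ᶠ i in (p : Filter ι), dist (F i x) (f x) < ε / 2 :=
    Metric.tendsto_nhds.1 (hf x hx).2 _ (by positivity)
  have h2 : ∀ᶠ y in 𝓝 x, y ∈ ball x (min R (R * ε / 16)) :=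
    ball_mem_nhds _ (by positivity)
  filter_upwards [h1.prod_mk h2] with y hy
  obtain ⟨hy1, hy2⟩ := hy
  have hyR : y.2 ∈ ball x R := ball_subset_ball (min_le_left _ _) hy2
  have hyd : 2 / R * dist y.2 x ≤ ε / 8 := by
    have : dist y.2 x ≤ R * ε / 16 := (mem_ball.1 (ball_subset_ball (min_le_right _ _) hy2)).le
    calc 2 / R * dist y.2 x ≤ 2 / R * (R * ε / 16) := by gcongr
      _ = ε / 8 := by field_simp; norm_num
  have h3 := hlip y.1 y.2 hyR
  have h4 := hlipf y.2 hyR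
  change dist (f y.2) (F y.1 y.2) < ε
  calc dist (f y.2) (F y.1 y.2)
      ≤ dist (f y.2) (f x) + dist (f x) (F y.1 x) + dist (F y.1 x) (F y.1 y.2) :=
        dist_triangle4 _ _ _ _
    _ < ε := by rw [dist_comm (f x) (F y.1 x), dist_comm (F y.1 x) (F y.1 y.2)]; linarith

/-! ### Möbius automorphisms of the disc. -/

/-- The automorphism `z ↦ (z - a) / (1 - ā z)` of the unit disc. -/
noncomputable def mob (a z : ℂ) : ℂ := (z - a) / (1 - conj a * z)

theorem normSq_one_sub_conj_mul (a z : ℂ) :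
    ‖1 - conj a * z‖ ^ 2 = ‖z - a‖ ^ 2 + (1 - ‖a‖ ^ 2) * (1 - ‖z‖ ^ 2) := by
  simp only [← Complex.normSq_eq_norm_sq, Complex.normSq_apply, Complex.sub_re, Complex.sub_im,
    Complex.mul_re, Complex.mul_im, Complex.conj_re, Complex.conj_im, Complex.one_re,
    Complex.one_im]
  ring

theorem one_sub_conj_mul_ne_zero {a z : ℂ} (ha : ‖a‖ < 1) (hz : ‖z‖ ≤ 1) :
    1 - conj a * z ≠ 0 := by
  intro h
  have h1 : conj a * z = 1 := (sub_eq_zero.1 h).symm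
  have h2 : ‖a‖ * ‖z‖ = 1 := by
    rw [← Complex.norm_conj a, ← norm_mul, h1, norm_one]
  nlinarith [norm_nonneg a, norm_nonneg z]

theorem one_sub_norm_mob_sq {a z : ℂ} (ha : ‖a‖ < 1) (hz : ‖z‖ ≤ 1) :
    1 - ‖mob a z‖ ^ 2 = (1 - ‖a‖ ^ 2) * (1 - ‖z‖ ^ 2) / ‖1 - conj a * z‖ ^ 2 := by
  have h0 : ‖1 - conj a * z‖ ≠ 0 := norm_ne_zero_iff.2 (one_sub_conj_mul_ne_zero ha hz)
  rw [mob, norm_div, div_pow, eq_div_iff (by positivity), sub_mul,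
    div_mul_cancel₀ _ (by positivity), normSq_one_sub_conj_mul]
  ring

theorem norm_mob_lt_one {a z : ℂ} (ha : ‖a‖ < 1) (hz : ‖z‖ < 1) : ‖mob a z‖ < 1 := by
  have h := one_sub_norm_mob_sq ha hz.le
  have h0 : 0 < ‖1 - conj a * z‖ := norm_pos_iff.2 (one_sub_conj_mul_ne_zero ha hz.le)
  have h1 : 0 < 1 - ‖a‖ ^ 2 := by nlinarith [norm_nonneg a]
  have h2 : 0 < 1 - ‖z‖ ^ 2 := by nlinarith [norm_nonneg z]
  have h3 : 0 < 1 - ‖mob a z‖ ^ 2 := by rw [h]; positivity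
  nlinarith [norm_nonneg (mob a z)]

theorem mapsTo_mob {a : ℂ} (ha : ‖a‖ < 1) : MapsTo (mob a) disc disc := fun z hz => by
  rw [mem_ball_zero_iff] at hz ⊢
  exact norm_mob_lt_one ha hz

theorem hasDerivAt_mob {a z : ℂ} (h : 1 - conj a * z ≠ 0) :
    HasDerivAt (mob a) ((1 - conj a * a) / (1 - conj a * z) ^ 2) z := by
  have h1 : HasDerivAt (fun z => z - a) 1 z := (hasDerivAt_id z).sub_const a
  have h2 : HasDerivAt (fun z => 1 - conj a * z) (-(conj a)) z := by
    simpa using ((hasDerivAt_id z).const_mul (conj a)).const_sub 1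
  have h3 := h1.div h2 h
  rwa [show 1 * (1 - conj a * z) - (z - a) * -conj a = 1 - conj a * a by ring] at h3

theorem differentiableOn_mob {a : ℂ} (ha : ‖a‖ < 1) : DifferentiableOn ℂ (mob a) disc :=
  fun _ hz => (hasDerivAt_mob (one_sub_conj_mul_ne_zero ha
    (mem_ball_zero_iff.1 hz).le)).differentiableAt.differentiableWithinAt

@[simp] theorem mob_self (a : ℂ) : mob a a = 0 := by simp [mob]

@[simp] theorem mob_zero_right (a : ℂ) : mob a 0 = -a := by simp [mob]

theorem mob_eq_zero_iff {a z : ℂ} (ha : ‖a‖ < 1) (hz : ‖z‖ < 1) : mob a z = 0 ↔ z = a := by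
  rw [mob, div_eq_zero_iff, or_iff_left (one_sub_conj_mul_ne_zero ha hz.le), sub_eq_zero]

theorem injOn_mob {a : ℂ} (ha : ‖a‖ < 1) : InjOn (mob a) disc := by
  intro z hz w hw h
  rw [mem_ball_zero_iff] at hz hw
  rw [mob, mob, div_eq_div_iff (one_sub_conj_mul_ne_zero ha hz.le)
    (one_sub_conj_mul_ne_zero ha hw.le)] at h
  have h1 := one_sub_conj_mul_ne_zero ha ha.le
  have h2 : (1 - conj a * a) * (z - w) = 0 := by linear_combination h
  exact sub_eq_zero.1 ((mul_eq_zero.1 h2).resolve_left h1)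

/-! ### The Riemann mapping theorem by Koebe's extremal argument. -/

/-- `f` is an injective holomorphic map of `D` into the unit disc with `f 0 = 0`. -/
structure IsUnivalent (D : Set ℂ) (f : ℂ → ℂ) : Prop where
  differentiableOn : DifferentiableOn ℂ f D
  injOn : InjOn f D
  mapsTo : MapsTo f D disc
  map_zero : f 0 = 0
  deriv_ne_zero : ∀ z ∈ D, deriv f z ≠ 0

/-- Koebe's square root step. -/
theorem IsUnivalent.exists_norm_deriv_lt {D : Set ℂ} {g : ℂ → ℂ} (hg : IsUnivalent D g)
    (ho : IsOpen D) (h0 : 0 ∈ D) (hlog : HasContLog D) {a : ℂ} (ha : a ∈ disc)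
    (hag : a ∉ g '' D) : ∃ G, IsUnivalent D G ∧ ‖deriv g 0‖ < ‖deriv G 0‖ := by
  have ha1 : ‖a‖ < 1 := mem_ball_zero_iff.1 ha
  have hgn : ∀ z ∈ D, ‖g z‖ < 1 := fun z hz => mem_ball_zero_iff.1 (hg.mapsTo hz)
  have hq : ∀ z ∈ D, HasDerivAt (fun z => mob a (g z))
      ((1 - conj a * a) / (1 - conj a * g z) ^ 2 * deriv g z) z := fun z hz =>
    (hasDerivAt_mob (one_sub_conj_mul_ne_zero ha1 (hgn z hz).le)).comp z
      (hg.differentiableOn.differentiableAt (ho.mem_nhds hz)).hasDerivAt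
  have hq0 : ∀ z ∈ D, mob a (g z) ≠ 0 := fun z hz h => by
    rw [mob_eq_zero_iff ha1 (hgn z hz)] at h
    exact hag ⟨z, hz, h⟩
  obtain ⟨s, ds, hs⟩ := hlog.exists_sqrt ho
    (fun z hz => (hq z hz).differentiableAt.differentiableWithinAt) hq0
  have hs0 : ∀ z ∈ D, s z ≠ 0 := fun z hz h => hq0 z hz (by rw [← hs z hz, h]; simp)
  have hsn : ∀ z ∈ D, ‖s z‖ < 1 := fun z hz => by
    have h1 := norm_mob_lt_one ha1 (hgn z hz)
    rw [← hs z hz, norm_pow] at h1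
    nlinarith [norm_nonneg (s z)]
  have hds : ∀ z ∈ D, HasDerivAt s _ z := fun z hz =>
    hasDerivAt_of_sq (ds.differentiableAt (ho.mem_nhds hz)).continuousAt (hq z hz)
      (by filter_upwards [ho.mem_nhds hz] with w hw using hs w hw) (hs0 z hz)
  have hdG : ∀ z ∈ D, HasDerivAt (fun z => mob (s 0) (s z)) _ z := fun z hz =>
    (hasDerivAt_mob (one_sub_conj_mul_ne_zero (hsn 0 h0) (hsn z hz).le)).comp z (hds z hz)
  have hnz : ∀ b : ℂ, ‖b‖ < 1 → 1 - conj b * b ≠ 0 := fun b hb =>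
    one_sub_conj_mul_ne_zero hb hb.le
  refine ⟨fun z => mob (s 0) (s z), ⟨fun z hz =>
    (hdG z hz).differentiableAt.differentiableWithinAt, ?_, ?_, by simp, ?_⟩, ?_⟩
  · intro z hz w hw h
    have h1 := injOn_mob (hsn 0 h0) (mem_ball_zero_iff.2 (hsn z hz))
      (mem_ball_zero_iff.2 (hsn w hw)) h
    have h2 : mob a (g z) = mob a (g w) := by rw [← hs z hz, ← hs w hw, h1]
    exact hg.injOn hz hw (injOn_mob ha1 (hg.mapsTo hz) (hg.mapsTo hw) h2)
  · exact fun z hz => mapsTo_mob (hsn 0 h0) (mem_ball_zero_iff.2 (hsn z hz))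
  · intro z hz
    rw [(hdG z hz).deriv]
    have h1 := one_sub_conj_mul_ne_zero (hsn 0 h0) (hsn z hz).le
    have h2 := one_sub_conj_mul_ne_zero ha1 (hgn z hz).le
    have h3 := hg.deriv_ne_zero z hz
    have h4 := hs0 z hz
    have h5 := hnz a ha1
    have h6 := hnz _ (hsn 0 h0)
    refine mul_ne_zero (div_ne_zero h6 (pow_ne_zero 2 h1))
      (div_ne_zero (mul_ne_zero (div_ne_zero h5 (pow_ne_zero 2 h2)) h3) (by simpa using h4))
  · rw [(hdG 0 h0).deriv, hg.map_zero]
    have hsa : ‖s 0‖ ^ 2 = ‖a‖ := by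
      rw [← norm_pow, hs 0 h0, hg.map_zero, mob_zero_right, norm_neg]
    have hsp : 0 < ‖s 0‖ := norm_pos_iff.2 (hs0 0 h0)
    have hs1 := hsn 0 h0
    have hgp : 0 < ‖deriv g 0‖ := norm_pos_iff.2 (hg.deriv_ne_zero 0 h0)
    have hn : ∀ b : ℂ, ‖b‖ < 1 → ‖1 - conj b * b‖ = 1 - ‖b‖ ^ 2 := fun b hb => by
      rw [← Complex.normSq_eq_conj_mul_self, ← Complex.ofReal_one, ← Complex.ofReal_sub,
        Complex.norm_real, Complex.normSq_eq_norm_sq, Real.norm_of_nonneg]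
      nlinarith [norm_nonneg b]
    simp only [mul_zero, sub_zero, one_pow, div_one, norm_mul, norm_div, norm_pow, hn a ha1,
      hn _ hs1, Complex.norm_two]
    rw [← hsa]
    have hp : 0 < 1 - ‖s 0‖ ^ 2 := by nlinarith
    -- The derivative grows by (1 + r²)/(2r) with r = |s 0| = √|a| < 1, which exceeds 1 because (1 -
    -- r)² > 0.
    have : (1 - ‖s 0‖ ^ 2) / (1 - ‖s 0‖ ^ 2) ^ 2 *
        ((1 - (‖s 0‖ ^ 2) ^ 2) * ‖deriv g 0‖ / (2 * ‖s 0‖)) =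
        (1 + ‖s 0‖ ^ 2) / (2 * ‖s 0‖) * ‖deriv g 0‖ := by
      field_simp
      ring
    rw [this]
    refine lt_mul_of_one_lt_left hgp ?_
    rw [one_lt_div (by positivity)]
    nlinarith [sq_pos_of_pos (sub_pos.2 hs1)]

theorem IsUnivalent.norm_deriv_le {D : Set ℂ} {g : ℂ → ℂ} (hg : IsUnivalent D g) {r : ℝ}
    (hr : 0 < r) (hD : ball 0 r ⊆ D) : ‖deriv g 0‖ ≤ 1 / r := by
  refine Complex.norm_deriv_le_div_of_mapsTo_ball (hg.differentiableOn.mono hD) ?_ hr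
  rw [hg.map_zero]
  exact (hg.mapsTo.mono_left hD).mono_right ball_subset_closedBall

/-- The extremal univalent map exists. -/
theorem exists_isUnivalent_isMax {D : Set ℂ} (ho : IsOpen D) (hc : IsPreconnected D)
    (h0 : 0 ∈ D) (hD : D ⊆ disc) :
    ∃ g, IsUnivalent D g ∧ ∀ G, IsUnivalent D G → ‖deriv G 0‖ ≤ ‖deriv g 0‖ := by
  obtain ⟨r, hr, hrD⟩ := Metric.isOpen_iff.1 ho 0 h0
  set S : Set ℝ := {x | ∃ G, IsUnivalent D G ∧ ‖deriv G 0‖ = x}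
  have hbdd : BddAbove S := ⟨1 / r, by
    rintro _ ⟨G, hG, rfl⟩
    exact hG.norm_deriv_le hr hrD⟩
  have hid : IsUnivalent D id :=
    ⟨differentiableOn_id, injOn_id _, fun z hz => hD hz, rfl, fun z _ => by simp⟩
  have hS1 : (1 : ℝ) ∈ S := ⟨id, hid, by simp⟩
  have hM : 1 ≤ sSup S := le_csSup hbdd hS1
  have hex : ∀ n : ℕ, ∃ G, IsUnivalent D G ∧ sSup S - 1 / (n + 1 : ℝ) < ‖deriv G 0‖ := fun n => by
    obtain ⟨_, ⟨G, hG, rfl⟩, hlt⟩ := exists_lt_of_lt_csSup ⟨1, hS1⟩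
      (show sSup S - 1 / (n + 1 : ℝ) < sSup S by
        have : 0 < 1 / (n + 1 : ℝ) := by positivity
        linarith)
    exact ⟨G, hG, hlt⟩
  choose F hF hFlt using hex
  obtain ⟨g, hlim, hgm⟩ := exists_tendstoLocallyUniformlyOn (hyperfilter ℕ) ho
    (fun n => (hF n).differentiableOn) (fun n => (hF n).mapsTo)
  have hdg : DifferentiableOn ℂ g D :=
    hlim.differentiableOn (Eventually.of_forall fun n => (hF n).differentiableOn) ho
  have hlim' := hlim.deriv (Eventually.of_forall fun n => (hF n).differentiableOn) ho
  have hdg' : DifferentiableOn ℂ (deriv g) D := hdg.deriv ho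
  have hle : ((hyperfilter ℕ : Ultrafilter ℕ) : Filter ℕ) ≤ atTop := by
    rw [← Nat.cofinite_eq_atTop]
    exact hyperfilter_le_cofinite
  have hderiv : ‖deriv g 0‖ = sSup S := by
    have h1 : Tendsto (fun n => ‖deriv (F n) 0‖) (hyperfilter ℕ) (𝓝 ‖deriv g 0‖) :=
      (hlim'.tendsto_at h0).norm
    have h2 : Tendsto (fun n => ‖deriv (F n) 0‖) atTop (𝓝 (sSup S)) := by
      refine tendsto_of_tendsto_of_tendsto_of_le_of_le (g := fun n : ℕ => sSup S - 1 / (n + 1 : ℝ))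
        ?_ tendsto_const_nhds (fun n => (hFlt n).le) (fun n => le_csSup hbdd ⟨_, hF n, rfl⟩)
      simpa using (tendsto_one_div_add_atTop_nhds_zero_nat (𝕜 := ℝ)).const_sub (sSup S)
    exact tendsto_nhds_unique h1 (h2.mono_left hle)
  have hd0 : deriv g 0 ≠ 0 := norm_pos_iff.1 (by linarith)
  have hgz : g 0 = 0 := tendsto_nhds_unique (hlim.tendsto_at h0)
    (by simp only [(hF _).map_zero]; exact tendsto_const_nhds)
  have hnc : ¬ ∃ c, EqOn g (fun _ => c) D := by
    rintro ⟨c, hcg⟩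
    refine hd0 ?_
    have : g =ᶠ[𝓝 0] fun _ => c := by filter_upwards [ho.mem_nhds h0] with w hw using hcg hw
    rw [this.deriv_eq, deriv_const]
  have han := hdg.analyticOnNhd ho
  have hne : ∀ c, ∀ z ∈ D, ∀ᶠ w in 𝓝[≠] z, g w - c ≠ 0 := fun c z hz => by
    rcases (han z hz).eventually_eq_or_eventually_ne analyticAt_const (g := fun _ => c)
      with h | h
    · exact absurd ⟨c, han.eqOn_of_preconnected_of_eventuallyEq analyticOnNhd_const hc hz h⟩ hnc
    · exact h.mono fun w hw => sub_ne_zero.2 hw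
  have hne' : ∀ z ∈ D, ∀ᶠ w in 𝓝[≠] z, deriv g w ≠ 0 := fun z hz => by
    have han' := hdg'.analyticOnNhd ho
    rcases (han' z hz).eventually_eq_or_eventually_ne analyticAt_const (g := fun _ => (0 : ℂ))
      with h | h
    · exact absurd (han'.eqOn_of_preconnected_of_eventuallyEq analyticOnNhd_const hc hz h h0) hd0
    · exact h
  have hU : IsUnivalent D g := by
    refine ⟨hdg, ?_, ?_, hgz, ?_⟩
    · intro z hz w hw hzw
      by_contra hne2
      obtain ⟨V, W, hV, hW, hVW⟩ := t2_separation_nhds hne2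
      -- Hurwitz for `F n u - F n z`: a second point w with g w = g z would give `F n` the value `F
      -- n z` near w, against injectivity.
      have hlimc : TendstoLocallyUniformlyOn (fun n u => F n u - F n z) (fun u => g u - g z)
          (hyperfilter ℕ) D := by
        rw [ho.tendstoLocallyUniformlyOn_iff_forall_tendsto] at hlim ⊢
        intro x hx
        have h1 := hlim x hx
        have h2 : Tendsto (fun y : ℕ × ℂ => (g z, F y.1 z)) ((hyperfilter ℕ : Filter ℕ) ×ˢ 𝓝 x)
            (uniformity ℂ) := by
          have := ((hlim z hz).comp
            (tendsto_fst.prodMk (tendsto_const_nhds (x := z)) : Tendsto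
              (fun y : ℕ × ℂ => (y.1, z)) ((hyperfilter ℕ : Filter ℕ) ×ˢ 𝓝 x) _))
          exact this
        exact h1.uniformity_sub h2
      have h3 := exists_zero_of_tendstoLocallyUniformlyOn ho
        (fun n => (hF n).differentiableOn.sub_const _) hlimc
        (hdg.continuousOn.sub continuousOn_const) hw (by simp [hzw]) (hne _ w hw)
        (inter_mem hW (ho.mem_nhds hw))
      obtain ⟨n, u, ⟨huW, huD⟩, hun⟩ := h3.exists
      have huz : u = z := (hF n).injOn huD hz (sub_eq_zero.1 hun)
      exact disjoint_left.1 hVW (huz ▸ mem_of_mem_nhds hV) huW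
    · have himg : IsOpen (g '' D) := by
        rcases han.is_constant_or_isOpen hc with ⟨c, h⟩ | h
        · exact absurd ⟨c, h⟩ hnc
        · exact h D Subset.rfl ho
      have hsub : g '' D ⊆ interior (closedBall 0 1) :=
        interior_maximal (image_subset_iff.2 hgm) himg
      rw [interior_closedBall _ one_ne_zero] at hsub
      exact image_subset_iff.1 hsub
    -- Nonvanishing of the derivative is carried in `IsUnivalent`, so it passes to the limit by
    -- Hurwitz applied to the derivatives.
    · intro z hz hz0
      have h3 := exists_zero_of_tendstoLocallyUniformlyOn ho
        (fun n => ((hF n).differentiableOn.deriv ho)) hlim' hdg'.continuousOn hz hz0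
        (hne' z hz) (ho.mem_nhds hz)
      obtain ⟨n, u, hu, hu0⟩ := h3.exists
      exact (hF n).deriv_ne_zero u hu hu0
  refine ⟨g, hU, fun G hG => ?_⟩
  rw [hderiv]
  exact le_csSup hbdd ⟨G, hG, rfl⟩

/-- The inverse of an injective holomorphic map with nonvanishing derivative is holomorphic. -/
theorem differentiableOn_inverse {D E : Set ℂ} {f g : ℂ → ℂ} (ho : IsOpen D)
    (hf : DifferentiableOn ℂ f D) (hinj : InjOn f D) (hne : ∀ z ∈ D, deriv f z ≠ 0)
    (hg : MapsTo g E D) (hfg : RightInvOn g f E) : DifferentiableOn ℂ g E := by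
  intro w hw
  have hz := hg hw
  have hs : HasStrictDerivAt f (deriv f (g w)) (g w) :=
    (hf.analyticOnNhd ho _ hz).hasStrictDerivAt
  have hl := hs.to_localInverse (hne _ hz)
  have hev := hs.eventually_right_inverse (hne _ hz)
  rw [hfg hw] at hl hev
  have hmem : ∀ᶠ y in 𝓝 w, hs.localInverse f _ _ (hne _ hz) y ∈ D := by
    refine hl.hasDerivAt.continuousAt.eventually_mem (ho.mem_nhds ?_)
    have := (hs.hasStrictFDerivAt_equiv (hne _ hz)).localInverse_apply_image
    rw [hfg hw] at this
    rwa [show hs.localInverse f _ _ (hne _ hz) w = g w from this]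
  refine (hl.hasDerivAt.differentiableAt.differentiableWithinAt (s := E)).congr_of_eventuallyEq_of_mem
    ?_ hw
  filter_upwards [hmem.filter_mono nhdsWithin_le_nhds, hev.filter_mono nhdsWithin_le_nhds,
    self_mem_nhdsWithin] with y hy1 hy2 hy3
  exact hinj (hg hy3) hy1 (by rw [hfg hy3, hy2])

/-- The Riemann mapping theorem for subregions of the unit disc. -/
theorem exists_isConformalFromDisc {D : Set ℂ} (ho : IsOpen D) (hc : IsPreconnected D)
    (h0 : 0 ∈ D) (hD : D ⊆ disc) (hlog : HasContLog D) : ∃ f, IsConformalFromDisc f D 0 := by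
  obtain ⟨g, hg, hmax⟩ := exists_isUnivalent_isMax ho hc h0 hD
  have hsurj : SurjOn g D disc := by
    intro a ha
    by_contra hag
    obtain ⟨G, hG, hlt⟩ := hg.exists_norm_deriv_lt ho h0 hlog ha hag
    exact absurd (hmax G hG) (not_le.2 hlt)
  have hb : BijOn g D disc := ⟨hg.mapsTo, hg.injOn, hsurj⟩
  have hinv := hb.invOn_invFunOn
  have hm : MapsTo (Function.invFunOn g D) disc D := hsurj.mapsTo_invFunOn
  refine ⟨Function.invFunOn g D, differentiableOn_inverse ho hg.differentiableOn hg.injOn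
    hg.deriv_ne_zero hm hinv.2, hinv.symm.bijOn hm hg.mapsTo, ⟨g, hg.differentiableOn,
    hinv.symm⟩, ?_⟩
  have h := hinv.1 h0
  rwa [hg.map_zero] at h

/-! ### Eilenberg's theorem: zeros of a smooth approximation and their removal. -/

/-- `q` has a continuous logarithm on a punctured neighbourhood of `a`. -/
def HasPuncturedLog (q : ℂ → ℂ) (a : ℂ) : Prop :=
  ∃ l : ℂ → ℂ, ∀ᶠ z in 𝓝[≠] a, ContinuousAt l z ∧ Complex.exp (l z) = q z

theorem mem_slitPlane_of_norm_sub_one_lt {u : ℂ} (h : ‖u - 1‖ < 1) : u ∈ Complex.slitPlane := by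
  simpa using Complex.mem_slitPlane_of_norm_lt_one h

theorem hasPuncturedLog_of_norm_sub_lt {q : ℂ → ℂ} {a γ : ℂ}
    (h : ∀ᶠ z in 𝓝[≠] a, ContinuousAt q z ∧ ‖q z - γ‖ < ‖γ‖) : HasPuncturedLog q a := by
  refine ⟨fun z => Complex.log (q z / γ) + Complex.log γ, ?_⟩
  filter_upwards [h] with z ⟨hc, hz⟩
  have hγ : γ ≠ 0 := norm_pos_iff.1 ((norm_nonneg _).trans_lt hz)
  have hs : q z / γ ∈ Complex.slitPlane := mem_slitPlane_of_norm_sub_one_lt <| by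
    rwa [div_sub_one hγ, norm_div, div_lt_one (norm_pos_iff.2 hγ)]
  refine ⟨((hc.div_const γ).clog hs).add continuousAt_const, ?_⟩
  rw [Complex.exp_add, Complex.exp_log (Complex.slitPlane_ne_zero hs), Complex.exp_log hγ,
    div_mul_cancel₀ _ hγ]

theorem HasPuncturedLog.div {q k : ℂ → ℂ} {a : ℂ} (hq : HasPuncturedLog q a)
    (hk : HasPuncturedLog k a) : HasPuncturedLog (fun z => q z / k z) a := by
  obtain ⟨l, hl⟩ := hq
  obtain ⟨m, hm⟩ := hk
  refine ⟨fun z => l z - m z, ?_⟩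
  filter_upwards [hl, hm] with z h1 h2
  exact ⟨h1.1.sub h2.1, by rw [Complex.exp_sub, h1.2, h2.2]⟩

theorem hasPuncturedLog_of_continuous {k : ℂ → ℂ} {a : ℂ} (hk : Continuous k) (h : k a ≠ 0) :
    HasPuncturedLog k a := by
  refine hasPuncturedLog_of_norm_sub_lt (γ := k a) (Eventually.filter_mono nhdsWithin_le_nhds ?_)
  have h1 : Tendsto (fun z => ‖k z - k a‖) (𝓝 a) (𝓝 0) := by
    simpa using (hk.tendsto a).sub_const (k a) |>.norm
  filter_upwards [h1.eventually_lt_const (norm_pos_iff.2 h)] with z hz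
  exact ⟨hk.continuousAt, hz⟩

/-- A real-linear map is `h ↦ α h + β h̄`. -/
theorem realLinear_apply_eq (A : ℂ →L[ℝ] ℂ) (h : ℂ) :
    A h = (A 1 - Complex.I * A Complex.I) / 2 * h +
      (A 1 + Complex.I * A Complex.I) / 2 * conj h := by
  have h1 : A h = h.re * A 1 + h.im * A Complex.I := by
    conv_lhs => rw [← Complex.re_add_im h]
    rw [map_add, show (h.re : ℂ) = h.re • (1 : ℂ) by simp,
      show (h.im : ℂ) * Complex.I = h.im • Complex.I by simp, map_smul, map_smul]
    simp
  have h2 : conj h = h.re - h.im * Complex.I := by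
    rw [← Complex.re_add_im (conj h)]
    simp [sub_eq_add_neg]
  rw [h1, h2]
  conv_rhs => rw [← Complex.re_add_im h]
  simp only [Complex.add_re, Complex.add_im, Complex.ofReal_re, Complex.ofReal_im, Complex.mul_re,
    Complex.mul_im, Complex.I_re, Complex.I_im]
  ring_nf
  simp only [Complex.I_sq]
  ring

/-- If |α| = |β| ≠ 0, a square root z of -β/α is unimodular and is killed by A, since α z² + β = 0
and z z̄ = 1. -/
theorem norm_ne_norm_of_det_ne_zero {A : ℂ →L[ℝ] ℂ} (hA : A.det ≠ 0) {α β : ℂ}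
    (h : ∀ h, A h = α * h + β * conj h) : ‖α‖ ≠ ‖β‖ := by
  intro hab
  have hinj : ∀ z, A z = 0 → z = 0 := fun z hz =>
    (A.toContinuousLinearEquivOfDetNeZero hA).map_eq_zero_iff.1 hz
  by_cases hα : α = 0
  · have hβ : β = 0 := by simpa [hα, eq_comm] using hab
    exact one_ne_zero (hinj 1 (by simp [h, hα, hβ]))
  · obtain ⟨z, hz⟩ := IsAlgClosed.exists_pow_nat_eq (-(β / α)) two_pos
    have hn : ‖z‖ = 1 := by
      have : ‖z‖ ^ 2 = 1 := by
        rw [← norm_pow, hz, norm_neg, norm_div, hab, div_self]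
        rw [← hab]
        exact norm_ne_zero_iff.2 hα
      nlinarith [norm_nonneg z]
    have hz0 : z ≠ 0 := norm_pos_iff.1 (by rw [hn]; exact one_pos)
    refine hz0 (hinj z ?_)
    have hc : z * conj z = 1 := by rw [Complex.mul_conj, Complex.normSq_eq_norm_sq, hn]; simp
    have h1 : α * z ^ 2 + β = 0 := by rw [hz]; field_simp; ring
    rw [h]
    refine (mul_eq_zero.1 (?_ : z * (α * z + β * conj z) = 0)).resolve_left hz0
    linear_combination h1 + β * hc

/-- Near a nondegenerate zero, a map behaves like `z - a` or like its conjugate. -/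
theorem exists_hasPuncturedLog_div {q : ℂ → ℂ} (hq : Continuous q) {a : ℂ} (h0 : q a = 0)
    {A : ℂ →L[ℝ] ℂ} (hA : HasFDerivAt q A a) (hdet : A.det ≠ 0) :
    ∃ e : ℂ → ℂ, ((e = fun z => z - a) ∨ (e = fun z => conj (z - a))) ∧
      HasPuncturedLog (fun z => q z / e z) a := by
  obtain ⟨α, β, hαβ⟩ : ∃ α β, ∀ h, A h = α * h + β * conj h := ⟨_, _, realLinear_apply_eq A⟩
  have hne := norm_ne_norm_of_det_ne_zero hdet hαβ
  -- When γ dominates δ, the quotient q/e stays near a in a disc about γ that misses 0, where the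
  -- principal logarithm serves. Whichever of α, β is larger selects e.
  have key : ∀ (e : ℂ → ℂ) (γ δ : ℂ), Continuous e → (∀ z, ‖e z‖ = ‖z - a‖) → ‖δ‖ < ‖γ‖ →
      (∀ z, ‖A (z - a) - γ * e z‖ ≤ ‖δ‖ * ‖z - a‖) → HasPuncturedLog (fun z => q z / e z) a := by
    intro e γ δ he hen hδ hb
    refine hasPuncturedLog_of_norm_sub_lt (γ := γ) ?_
    have hc : 0 < (‖γ‖ - ‖δ‖) / 2 := by linarith
    filter_upwards [(hA.isLittleO.bound hc).filter_mono nhdsWithin_le_nhds,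
      self_mem_nhdsWithin] with z hz hza
    have hpos : 0 < ‖z - a‖ := norm_pos_iff.2 (sub_ne_zero.2 hza)
    have he0 : e z ≠ 0 := norm_pos_iff.1 (by rwa [hen])
    refine ⟨hq.continuousAt.div he.continuousAt he0, ?_⟩
    rw [div_sub' he0, norm_div, hen, div_lt_iff₀ hpos]
    rw [h0, sub_zero] at hz
    have h1 := norm_add_le (q z - A (z - a)) (A (z - a) - γ * e z)
    rw [sub_add_sub_cancel] at h1
    rw [mul_comm (e z)]
    nlinarith [hb z]
  rcases lt_or_gt_of_ne hne with h | h
  · refine ⟨_, Or.inr rfl, key _ β α (by fun_prop) (fun z => Complex.norm_conj _) h fun z => ?_⟩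
    rw [hαβ, add_sub_cancel_right, norm_mul]
  · refine ⟨_, Or.inl rfl, key _ α β (by fun_prop) (fun z => rfl) h fun z => ?_⟩
    rw [hαβ, add_sub_cancel_left, norm_mul, Complex.norm_conj]

/-- A map with a logarithm near the point `a` can be changed near `a` to become nonvanishing
there. -/
theorem exists_continuousOn_of_hasPuncturedLog {q : ℂ → ℂ} {V L : Set ℂ} {S : Finset ℂ} {a : ℂ}
    (hV : IsOpen V) (hL : IsClosed L) (haS : a ∉ S) (haV : a ∈ V) (haL : a ∉ L)
    (hq : ∀ z ∈ V, z ∉ insert a S → ContinuousAt q z ∧ q z ≠ 0)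
    (hlog : ∀ b ∈ insert a S, HasPuncturedLog q b) :
    ∃ q' : ℂ → ℂ, (∀ z ∈ V, z ∉ S → ContinuousAt q' z ∧ q' z ≠ 0) ∧
      (∀ b ∈ S, HasPuncturedLog q' b) ∧ ∀ z ∈ L, q' z = q z := by
  obtain ⟨l, hl⟩ := hlog a (Finset.mem_insert_self a S)
  rw [eventually_nhdsWithin_iff] at hl
  obtain ⟨δ, hδ, hsub⟩ : ∃ δ > 0, ball a (2 * δ) ⊆
      {z | z ∈ ({a}ᶜ : Set ℂ) → ContinuousAt l z ∧ Complex.exp (l z) = q z} ∩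
        (V ∩ Lᶜ ∩ (S : Set ℂ)ᶜ) := by
    obtain ⟨ε, hε, h⟩ := Metric.nhds_basis_ball.mem_iff.1 (inter_mem hl (inter_mem (inter_mem
      (hV.mem_nhds haV) (hL.isOpen_compl.mem_nhds haL))
      (S.finite_toSet.isClosed.isOpen_compl.mem_nhds (by simpa using haS))))
    exact ⟨ε / 2, by positivity, by rwa [mul_div_cancel₀ _ two_ne_zero]⟩
  let χ : ℂ → ℝ := fun z => max 0 (min 1 (2 * dist z a / δ - 1))
  have hχc : Continuous χ := by fun_prop
  have hχ1 : ∀ z, δ ≤ dist z a → χ z = 1 := fun z hz => by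
    have : 1 ≤ 2 * dist z a / δ - 1 := by
      rw [le_sub_iff_add_le, le_div_iff₀ hδ]
      linarith
    simp [χ, min_eq_left this]
  have hχ0 : ∀ z, dist z a ≤ δ / 2 → χ z = 0 := fun z hz => by
    have : 2 * dist z a / δ - 1 ≤ 0 := by
      rw [sub_nonpos, div_le_one hδ]
      linarith
    simp [χ, min_eq_right (this.trans zero_le_one), max_eq_left this]
  -- Close to a, χ = 0 and q exp(u) = exp(l - l) = 1; at distance at least δ, χ = 1 and q is
  -- unchanged.
  let u : ℂ → ℂ := fun z => (χ z - 1) * l z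
  have hu0 : ∀ z, δ ≤ dist z a → u z = 0 := fun z hz => by simp [u, hχ1 z hz]
  classical
  let q' : ℂ → ℂ := fun z => if z = a then 1 else q z * Complex.exp (u z)
  have hq'ne : ∀ z, z ≠ a → q' z = q z * Complex.exp (u z) := fun z hz => if_neg hz
  have hq'far : ∀ z, δ ≤ dist z a → q' z = q z := fun z hz => by
    have : z ≠ a := by
      rintro rfl
      rw [dist_self] at hz
      linarith
    rw [hq'ne z this, hu0 z hz, Complex.exp_zero, mul_one]
  have hfar : ∀ z, z ∉ ball a (2 * δ) → q' =ᶠ[𝓝 z] q := fun z hz => by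
    have : ∀ᶠ w in 𝓝 z, δ < dist w a := by
      refine (continuous_id.dist continuous_const).continuousAt.eventually_const_lt ?_
      rw [mem_ball, not_lt] at hz
      change δ < dist z a
      linarith
    filter_upwards [this] with w hw using hq'far w hw.le
  have hnear : q' =ᶠ[𝓝 a] fun _ => 1 := by
    filter_upwards [ball_mem_nhds a (half_pos hδ)] with w hw
    by_cases hwa : w = a
    · simp [q', hwa]
    · have h1 := (hsub (ball_subset_ball (by linarith) hw)).1 hwa
      rw [hq'ne w hwa, ← h1.2, ← Complex.exp_add]
      simp [u, hχ0 w (mem_ball.1 hw).le]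
  refine ⟨q', fun z hz hzS => ?_, fun b hb => ?_, fun z hz => ?_⟩
  · by_cases hza : z = a
    · subst hza
      refine ⟨continuousAt_const.congr hnear.symm, ?_⟩
      rw [hnear.self_of_nhds]
      exact one_ne_zero
    · have hqz := hq z hz (by simp [hza, hzS])
      by_cases hzb : z ∈ ball a (2 * δ)
      · have h1 := (hsub hzb).1 hza
        have hev : q' =ᶠ[𝓝 z] fun z => q z * Complex.exp (u z) := by
          filter_upwards [isOpen_compl_singleton.mem_nhds hza] with w hw using hq'ne w hw
        refine ⟨ContinuousAt.congr ?_ hev.symm, ?_⟩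
        · refine hqz.1.mul (ContinuousAt.cexp ?_)
          exact ((Complex.continuous_ofReal.comp hχc).continuousAt.sub continuousAt_const).mul h1.1
        · rw [hq'ne z hza]
          exact mul_ne_zero hqz.2 (Complex.exp_ne_zero _)
      · exact ⟨hqz.1.congr (hfar z hzb).symm, by rw [(hfar z hzb).self_of_nhds]; exact hqz.2⟩
  · obtain ⟨m, hm⟩ := hlog b (Finset.mem_insert_of_mem hb)
    have hbb : b ∉ ball a (2 * δ) := fun h => (hsub h).2.2 hb
    refine ⟨m, ?_⟩
    filter_upwards [hm, (hfar b hbb).filter_mono nhdsWithin_le_nhds] with z h1 h2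
    exact ⟨h1.1, h1.2.trans h2.symm⟩
  · exact (hfar z fun h => (hsub h).2.1.2 hz).self_of_nhds

theorem exists_nonvanishing_of_hasPuncturedLog {V L : Set ℂ} (hV : IsOpen V) (hL : IsClosed L)
    (S : Finset ℂ) : ∀ q : ℂ → ℂ, (S : Set ℂ) ⊆ V → (∀ b ∈ S, b ∉ L) →
    (∀ z ∈ V, z ∉ S → ContinuousAt q z ∧ q z ≠ 0) → (∀ b ∈ S, HasPuncturedLog q b) →
    ∃ q' : ℂ → ℂ, (∀ z ∈ V, ContinuousAt q' z ∧ q' z ≠ 0) ∧ ∀ z ∈ L, q' z = q z := by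
  classical
  induction S using Finset.induction_on with
  | empty => exact fun q _ _ hq _ => ⟨q, fun z hz => hq z hz (Finset.notMem_empty z), fun _ _ => rfl⟩
  | insert a S haS ih =>
    intro q hSV hSL hq hlog
    obtain ⟨q₁, h1, h2, h3⟩ := exists_continuousOn_of_hasPuncturedLog hV hL haS
      (hSV (Finset.mem_insert_self a S)) (hSL a (Finset.mem_insert_self a S)) hq hlog
    obtain ⟨q₂, h4, h5⟩ := ih q₁ (fun b hb => hSV (Finset.mem_insert_of_mem hb))
      (fun b hb => hSL b (Finset.mem_insert_of_mem hb)) h1 h2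
    exact ⟨q₂, h4, fun z hz => (h5 z hz).trans (h3 z hz)⟩

theorem exists_pos_le_norm_of_isCompact {L : Set ℂ} (hL : IsCompact L) {g : ℂ → ℂ}
    (hg : ContinuousOn g L) (h0 : ∀ z ∈ L, g z ≠ 0) : ∃ m > 0, ∀ z ∈ L, m ≤ ‖g z‖ := by
  rcases L.eq_empty_or_nonempty with rfl | hne
  · exact ⟨1, one_pos, by simp⟩
  · obtain ⟨w, hw, hmin⟩ := hL.exists_isMinOn hne hg.norm
    exact ⟨‖g w‖, norm_pos_iff.2 (h0 w hw), fun z hz => hmin hz⟩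

/-- A continuous function on a compact set is uniformly close to a smooth function all of whose
zeros are nondegenerate. -/
theorem exists_nondegenerate_approx {L : Set ℂ} (hL : IsCompact L) {g : ℂ → ℂ}
    (hg : ContinuousOn g L) {m : ℝ} (hm : 0 < m) :
    ∃ q : ℂ → ℂ, Differentiable ℝ q ∧ (∀ z ∈ L, ‖q z - g z‖ < m) ∧
      ∀ z, q z = 0 → (fderiv ℝ q z).det ≠ 0 := by
  obtain ⟨G, hG⟩ := ContinuousMap.exists_restrict_eq hL.isClosed
    ⟨L.domRestrict g, continuousOn_iff_continuous_domRestrict.1 hg⟩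
  have hGg : ∀ z ∈ L, G z = g z := fun z hz => congrArg (fun f => f ⟨z, hz⟩) hG
  obtain ⟨p, hp, hpG, -⟩ := G.continuous.exists_contDiff_approx 1 (ε := fun _ => m / 2)
    continuous_const (fun _ => half_pos hm)
  have hdp : Differentiable ℝ p := hp.differentiable (by simp)
  have hsard : MeasureTheory.volume (p '' {z | (fderiv ℝ p z).det = 0}) = 0 :=
    MeasureTheory.addHaar_image_eq_zero_of_det_fderivWithin_eq_zero MeasureTheory.volume
      (fun z _ => (hdp z).hasFDerivAt.hasFDerivWithinAt) (fun z hz => hz)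
  -- By Sard's lemma arbitrarily small c are regular values of p; subtracting one makes every zero
  -- nondegenerate.
  obtain ⟨c, hc, hcp⟩ : ∃ c ∈ ball (0 : ℂ) (m / 2), c ∉ p '' {z | (fderiv ℝ p z).det = 0} := by
    by_contra! hcon
    exact (measure_ball_pos MeasureTheory.volume (0 : ℂ) (half_pos hm)).ne'
      (MeasureTheory.measure_mono_null hcon hsard)
  refine ⟨fun z => p z - c, hdp.sub_const c, fun z hz => ?_, fun z hz hdet => ?_⟩
  · have h1 := hpG z
    rw [hGg z hz, dist_eq_norm] at h1
    rw [mem_ball_zero_iff] at hc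
    calc ‖p z - c - g z‖ = ‖p z - g z - c‖ := by rw [sub_right_comm]
      _ ≤ ‖p z - g z‖ + ‖c‖ := norm_sub_le _ _
      _ < m := by linarith
  · rw [fderiv_sub_const] at hdet
    exact hcp ⟨z, hdet, sub_eq_zero.1 hz⟩

/-- An invertible derivative isolates each zero, so zeros cannot accumulate in a compact disc. -/
theorem finite_zeros_of_nondegenerate {q : ℂ → ℂ} (hq : Differentiable ℝ q)
    (hdet : ∀ z, q z = 0 → (fderiv ℝ q z).det ≠ 0) (R : ℝ) :
    {z | z ∈ closedBall (0 : ℂ) R ∧ q z = 0}.Finite := by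
  by_contra hinf
  obtain ⟨x, hx, hacc⟩ := Set.Infinite.exists_accPt_of_subset_isCompact hinf
    (isCompact_closedBall 0 R) (fun z hz => hz.1)
  rw [accPt_iff_frequently_nhdsNE] at hacc
  have hx0 : q x = 0 := by
    by_contra hne
    refine hacc (Eventually.filter_mono nhdsWithin_le_nhds ?_)
    filter_upwards [hq.continuous.continuousAt.eventually_ne hne] with z hz hz'
    exact hz hz'.2
  let A := (fderiv ℝ q x).toContinuousLinearEquivOfDetNeZero (hdet x hx0)
  have hA : HasFDerivAt q (A : ℂ →L[ℝ] ℂ) x := (hq x).hasFDerivAt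
  refine hacc ?_
  filter_upwards [hA.eventually_ne (c := (0 : ℂ)) ⟨_, A.antilipschitz⟩] with z hz hz'
  exact hz hz'.2

/-- **Eilenberg's theorem**: up to a factor with a logarithm, a nonvanishing continuous function
on a compact set `L` is a product of factors `z - a` and their conjugates, with `a ∉ L`. -/
theorem exists_eq_exp_mul_prod {L : Set ℂ} (hL : IsCompact L) {g : ℂ → ℂ}
    (hg : ContinuousOn g L) (h0 : ∀ z ∈ L, g z ≠ 0) :
    ∃ (S : Finset ℂ) (e : ℂ → ℂ → ℂ) (h : ℂ → ℂ), (∀ a ∈ S, a ∉ L) ∧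
      (∀ a ∈ S, (e a = fun z => z - a) ∨ (e a = fun z => conj (z - a))) ∧ ContinuousOn h L ∧
      ∀ z ∈ L, g z = Complex.exp (h z) * ∏ a ∈ S, e a z := by
  classical
  obtain ⟨m, hm, hmg⟩ := exists_pos_le_norm_of_isCompact hL hg h0
  obtain ⟨q, hq, hqg, hdet⟩ := exists_nondegenerate_approx hL hg hm
  obtain ⟨R, hR, hLR⟩ : ∃ R, 0 < R ∧ L ⊆ ball 0 R := hL.isBounded.subset_ball_lt 0 0
  have hratio : ∀ z ∈ L, q z / g z ∈ Complex.slitPlane := fun z hz =>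
    mem_slitPlane_of_norm_sub_one_lt <| by
      rw [div_sub_one (h0 z hz), norm_div, div_lt_one (norm_pos_iff.2 (h0 z hz))]
      exact (hqg z hz).trans_le (hmg z hz)
  have hqL : ∀ z ∈ L, q z ≠ 0 := fun z hz h => by
    have := Complex.slitPlane_ne_zero (hratio z hz)
    simp [h] at this
  have hfin : {z | z ∈ ball (0 : ℂ) R ∧ q z = 0}.Finite :=
    (finite_zeros_of_nondegenerate hq hdet R).subset fun z hz => ⟨ball_subset_closedBall hz.1, hz.2⟩
  set S := hfin.toFinset
  have hS : ∀ a, a ∈ S ↔ a ∈ ball (0 : ℂ) R ∧ q a = 0 := fun a => hfin.mem_toFinset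
  have hex : ∀ a, ∃ e : ℂ → ℂ, a ∈ S → ((e = fun z => z - a) ∨ (e = fun z => conj (z - a))) ∧
      HasPuncturedLog (fun z => q z / e z) a := fun a => by
    by_cases ha : a ∈ S
    · have ha0 := ((hS a).1 ha).2
      obtain ⟨e, he⟩ := exists_hasPuncturedLog_div hq.continuous ha0 (hq a).hasFDerivAt (hdet a ha0)
      exact ⟨e, fun _ => he⟩
    · exact ⟨id, fun h => absurd h ha⟩
  choose e he using hex
  have hec : ∀ a ∈ S, Continuous (e a) := fun a ha => by
    rcases (he a ha).1 with h | h <;> rw [h] <;> fun_prop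
  have he0 : ∀ a ∈ S, ∀ z, z ≠ a → e a z ≠ 0 := fun a ha z hz => by
    rcases (he a ha).1 with h | h <;> rw [h]
    · exact sub_ne_zero.2 hz
    · exact (map_ne_zero _).2 (sub_ne_zero.2 hz)
  let E : ℂ → ℂ := fun z => ∏ a ∈ S, e a z
  have hEc : Continuous E := continuous_finsetProd _ hec
  have hE0 : ∀ z, z ∉ S → E z ≠ 0 := fun z hz => Finset.prod_ne_zero_iff.2 fun a ha =>
    he0 a ha z fun h => hz (h ▸ ha)
  have hSL : ∀ b ∈ S, b ∉ L := fun b hb hbL => hqL b hbL ((hS b).1 hb).2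
  -- Off S the quotient q/E has no zeros, and at S it has punctured logarithms. It can therefore be
  -- replaced, without change on L, by a zero-free function on the whole ball, which has a
  -- logarithm.
  obtain ⟨q', hq', hq'L⟩ := exists_nonvanishing_of_hasPuncturedLog isOpen_ball hL.isClosed S
    (fun z => q z / E z) (fun b hb => ((hS b).1 hb).1) hSL
    (fun z hz hzS => ⟨hq.continuous.continuousAt.div hEc.continuousAt (hE0 z hzS),
      div_ne_zero (fun h => hzS ((hS z).2 ⟨hz, h⟩)) (hE0 z hzS)⟩)
    (fun b hb => by
      have h1 : HasPuncturedLog (fun z => ∏ a ∈ S.erase b, e a z) b :=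
        hasPuncturedLog_of_continuous
          (continuous_finsetProd _ fun a ha => hec a (Finset.mem_of_mem_erase ha))
          (Finset.prod_ne_zero_iff.2 fun a ha =>
            he0 a (Finset.mem_of_mem_erase ha) b (Finset.ne_of_mem_erase ha).symm)
      have h2 := (he b hb).2.div h1
      refine (congrArg (HasPuncturedLog · b) (funext fun z => ?_)).mp h2
      rw [div_div, Finset.mul_prod_erase S (fun a => e a z) hb])
  obtain ⟨h, hc, hh⟩ := (isSimplyConnectedRegion_of_convex isOpen_ball (convex_ball (0 : ℂ) R)
    ⟨0, by simpa using hR⟩).hasContLog q' (fun z hz => (hq' z hz).1.continuousWithinAt)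
    (fun z hz => (hq' z hz).2)
  refine ⟨S, e, fun z => h z - Complex.log (q z / g z), hSL, fun a ha => (he a ha).1, ?_, ?_⟩
  · exact (hc.mono hLR).sub ((hq.continuous.continuousOn.div hg h0).clog hratio)
  · intro z hz
    have hg0 := h0 z hz
    have hq0 := hqL z hz
    have hEz : E z ≠ 0 := hE0 z fun h => hSL z h hz
    rw [Complex.exp_sub, Complex.exp_log (Complex.slitPlane_ne_zero (hratio z hz)), hh z (hLR hz),
      hq'L z hz]
    change g z = q z / E z / (q z / g z) * E z
    field_simp

/-! ### Logarithms on compact sets, and their gluing over a region. -/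

/-- The function `z - a` has a continuous logarithm on `K`. -/
def HasLogAt (K : Set ℂ) (a : ℂ) : Prop :=
  ∃ l : ℂ → ℂ, ContinuousOn l K ∧ ∀ z ∈ K, Complex.exp (l z) = z - a

/-- The quotient (z - b)/(z - a) lies within 1 of 1, so its principal logarithm can be added. -/
theorem HasLogAt.of_norm_sub_lt {K : Set ℂ} {a b : ℂ} (ha : HasLogAt K a)
    (hab : ∀ z ∈ K, ‖a - b‖ < ‖z - a‖) : HasLogAt K b := by
  obtain ⟨l, hl, hla⟩ := ha
  have hne : ∀ z ∈ K, z - a ≠ 0 := fun z hz =>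
    norm_pos_iff.1 ((norm_nonneg _).trans_lt (hab z hz))
  have hs : ∀ z ∈ K, (z - b) / (z - a) ∈ Complex.slitPlane := fun z hz =>
    mem_slitPlane_of_norm_sub_one_lt <| by
      rw [div_sub_one (hne z hz), norm_div, div_lt_one (norm_pos_iff.2 (hne z hz)),
        sub_sub_sub_cancel_left]
      exact hab z hz
  refine ⟨fun z => l z + Complex.log ((z - b) / (z - a)), hl.add (ContinuousOn.clog ?_ hs), ?_⟩
  · exact (continuous_id.sub continuous_const).continuousOn.div
      (continuous_id.sub continuous_const).continuousOn hne
  · intro z hz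
    rw [Complex.exp_add, Complex.exp_log (Complex.slitPlane_ne_zero (hs z hz)), hla z hz,
      mul_div_cancel₀ _ (hne z hz)]

theorem hasLogAt_of_norm_lt {K : Set ℂ} {a : ℂ} (h : ∀ z ∈ K, ‖z‖ < ‖a‖) : HasLogAt K a := by
  rcases K.eq_empty_or_nonempty with rfl | ⟨w, hw⟩
  · exact ⟨id, by simp, by simp⟩
  have ha : -a ≠ 0 := neg_ne_zero.2 (norm_pos_iff.1 ((norm_nonneg _).trans_lt (h w hw)))
  have hs : ∀ z ∈ K, (z - a) / -a ∈ Complex.slitPlane := fun z hz =>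
    mem_slitPlane_of_norm_sub_one_lt <| by
      rw [div_sub_one ha, norm_div, div_lt_one (norm_pos_iff.2 ha), norm_neg]
      simpa using h z hz
  refine ⟨fun z => Complex.log ((z - a) / -a) + Complex.log (-a),
    (ContinuousOn.clog (by fun_prop) hs).add continuousOn_const, fun z hz => ?_⟩
  rw [Complex.exp_add, Complex.exp_log (Complex.slitPlane_ne_zero (hs z hz)), Complex.exp_log ha,
    div_mul_cancel₀ _ ha]

/-- Having a logarithm of z - a is locally constant in a off K, and it holds for |a| large. An
unbounded connected set carries it from infinity to a. -/
theorem hasLogAt_of_not_isBounded {K C : Set ℂ} (hK : IsCompact K) (hC : IsPreconnected C)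
    (hCK : C ⊆ Kᶜ) (hb : ¬ Bornology.IsBounded C) {a : ℂ} (ha : a ∈ C) : HasLogAt K a := by
  have hnear : ∀ c ∈ Kᶜ, ∃ r > 0, ball c r ⊆ Kᶜ ∧ ∀ b ∈ ball c r, (HasLogAt K b ↔ HasLogAt K c) := by
    intro c hc
    obtain ⟨r, hr, hrK⟩ := Metric.isOpen_iff.1 hK.isClosed.isOpen_compl c hc
    have hd : ∀ z ∈ K, r ≤ ‖z - c‖ := fun z hz => by
      by_contra! hlt
      exact hrK (by rwa [mem_ball, dist_eq_norm]) hz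
    refine ⟨r / 2, half_pos hr, (ball_subset_ball (by linarith)).trans hrK, fun b hb => ?_⟩
    rw [mem_ball, dist_eq_norm] at hb
    refine ⟨fun h => h.of_norm_sub_lt fun z hz => ?_, fun h => h.of_norm_sub_lt fun z hz => ?_⟩
    · have := norm_sub_norm_le (z - c) (b - c)
      rw [sub_sub_sub_cancel_right] at this
      linarith [hd z hz]
    · rw [norm_sub_rev]
      linarith [hd z hz]
  let T : Set ℂ := {c | c ∈ Kᶜ ∧ HasLogAt K c}
  let T' : Set ℂ := {c | c ∈ Kᶜ ∧ ¬ HasLogAt K c}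
  have hT : IsOpen T := Metric.isOpen_iff.2 fun c hc => by
    obtain ⟨r, hr, h1, h2⟩ := hnear c hc.1
    exact ⟨r, hr, fun b hb => ⟨h1 hb, (h2 b hb).2 hc.2⟩⟩
  have hT' : IsOpen T' := Metric.isOpen_iff.2 fun c hc => by
    obtain ⟨r, hr, h1, h2⟩ := hnear c hc.1
    exact ⟨r, hr, fun b hb => ⟨h1 hb, fun h => hc.2 ((h2 b hb).1 h)⟩⟩
  have hcov : C ⊆ T ∪ T' := fun c hc => by
    by_cases h : HasLogAt K c
    · exact Or.inl ⟨hCK hc, h⟩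
    · exact Or.inr ⟨hCK hc, h⟩
  rcases isPreconnected_iff_subset_of_disjoint.1 hC T T' hT hT' hcov (by
    ext c
    simp only [mem_inter_iff, mem_empty_iff_false, iff_false]
    exact fun h => h.2.2.2 h.2.1.2) with h | h
  · exact (h ha).2
  · exfalso
    obtain ⟨R, hR⟩ := hK.isBounded.subset_ball (0 : ℂ)
    obtain ⟨b, hbC, hbR⟩ : ∃ b ∈ C, R ≤ ‖b‖ := by
      by_contra! hcon
      exact hb ((isBounded_ball (x := (0 : ℂ)) (r := R)).subset fun b hb =>
        mem_ball_zero_iff.2 (hcon b hb))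
    exact (h hbC).2 (hasLogAt_of_norm_lt fun z hz =>
      (mem_ball_zero_iff.1 (hR hz)).trans_le hbR)

/-- If a compact `K` lies in a compact `L` such that the points off `L` are in unbounded components
of `Kᶜ`, then nonvanishing functions on `L` have logarithms on `K`. -/
theorem exists_log_of_hasLogAt {K L : Set ℂ} (hL : IsCompact L) (hKL : K ⊆ L)
    (hlog : ∀ a, a ∉ L → HasLogAt K a) {g : ℂ → ℂ} (hg : ContinuousOn g L)
    (h0 : ∀ z ∈ L, g z ≠ 0) : ∃ f : ℂ → ℂ, ContinuousOn f K ∧ ∀ z ∈ K, Complex.exp (f z) = g z := by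
  obtain ⟨S, e, h, hS, he, hc, hgh⟩ := exists_eq_exp_mul_prod hL hg h0
  have hex : ∀ a, ∃ l : ℂ → ℂ, a ∈ S → ContinuousOn l K ∧ ∀ z ∈ K, Complex.exp (l z) = e a z :=
    fun a => by
      by_cases ha : a ∈ S
      · obtain ⟨l, hl, hla⟩ := hlog a (hS a ha)
        rcases he a ha with h | h
        · exact ⟨l, fun _ => ⟨hl, fun z hz => by rw [h, hla z hz]⟩⟩
        · exact ⟨fun z => conj (l z), fun _ => ⟨Complex.continuous_conj.comp_continuousOn hl,
            fun z hz => by rw [h, Complex.exp_conj, hla z hz]⟩⟩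
      · exact ⟨id, fun h => absurd h ha⟩
  choose l hl using hex
  refine ⟨fun z => h z + ∑ a ∈ S, l a z, (hc.mono hKL).add
    (continuousOn_finsetSum _ fun a ha => (hl a ha).1), fun z hz => ?_⟩
  rw [Complex.exp_add, Complex.exp_sum, hgh z (hKL hz)]
  congr 1
  exact Finset.prod_congr rfl fun a ha => (hl a ha).2 z hz

/-- (f - g)/(2πi) is continuous and integer-valued on K. Were it nonzero at some point,
connectedness would make it take one of the values ±1/2. -/
theorem eqOn_of_exp_eqOn {K : Set ℂ} (hK : IsPreconnected K) {f g : ℂ → ℂ}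
    (hf : ContinuousOn f K) (hg : ContinuousOn g K)
    (h : ∀ z ∈ K, Complex.exp (f z) = Complex.exp (g z)) {z₀ : ℂ} (hz₀ : z₀ ∈ K)
    (h0 : f z₀ = g z₀) : EqOn f g K := by
  have hex : ∀ z ∈ K, ∃ n : ℤ, f z = g z + n * (2 * Real.pi * Complex.I) := fun z hz =>
    Complex.exp_eq_exp_iff_exists_int.1 (h z hz)
  have hpi : (2 * Real.pi * Complex.I : ℂ) ≠ 0 := Complex.two_pi_I_ne_zero
  let u : ℂ → ℝ := fun z => ((f z - g z) / (2 * Real.pi * Complex.I)).re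
  have hu : ContinuousOn u K :=
    Complex.continuous_re.comp_continuousOn ((hf.sub hg).div_const _)
  have hint : ∀ z ∈ K, ∃ n : ℤ, u z = n ∧ f z = g z + n * (2 * Real.pi * Complex.I) :=
    fun z hz => by
      obtain ⟨n, hn⟩ := hex z hz
      refine ⟨n, ?_, hn⟩
      change ((f z - g z) / (2 * Real.pi * Complex.I)).re = n
      rw [hn, add_sub_cancel_left, mul_div_cancel_right₀ _ hpi, Complex.intCast_re]
  intro z hz
  obtain ⟨n, hn, hfn⟩ := hint z hz
  have hu0 : u z₀ = 0 := by simp [u, h0]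
  suffices hn0 : n = 0 by simpa [hn0] using hfn
  by_contra hne
  have himg : IsPreconnected (u '' K) := hK.image u hu
  have hord := himg.ordConnected
  have hmem : ∀ x : ℝ, (∃ w ∈ K, u w = x) → ∃ k : ℤ, x = k := by
    rintro _ ⟨w, hw, rfl⟩
    obtain ⟨k, hk, -⟩ := hint w hw
    exact ⟨k, hk⟩
  have hhalf : ∀ k : ℤ, (k : ℝ) ≠ 1 / 2 ∧ (k : ℝ) ≠ -(1 / 2) := fun k => by
    constructor
    · intro hk
      have : (2 * k : ℝ) = 1 := by linarith
      norm_cast at this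
      omega
    · intro hk
      have : (2 * k : ℝ) = -1 := by linarith
      norm_cast at this
      omega
  rcases lt_or_gt_of_ne hne with hlt | hgt
  · have h1 : (n : ℝ) ≤ -1 := by exact_mod_cast Int.le_sub_one_of_lt hlt
    obtain ⟨k, hk⟩ := hmem (-(1 / 2)) (hord.out (⟨z, hz, rfl⟩ : u z ∈ u '' K)
      ⟨z₀, hz₀, rfl⟩ ⟨by rw [hn]; linarith, by rw [hu0]; norm_num⟩)
    exact (hhalf k).2 hk.symm
  · have h1 : (1 : ℝ) ≤ n := by exact_mod_cast hgt
    obtain ⟨k, hk⟩ := hmem (1 / 2) (hord.out (⟨z₀, hz₀, rfl⟩ : u z₀ ∈ u '' K)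
      ⟨z, hz, rfl⟩ ⟨by rw [hu0]; norm_num, by rw [hn]; linarith⟩)
    exact (hhalf k).1 hk.symm

/-- On a region, logarithms on the compact connected subsets can be glued. -/
theorem exists_log_of_forall_isCompact {D : Set ℂ} (ho : IsOpen D) (hc : IsConnected D)
    {g : ℂ → ℂ} (h0 : ∀ z ∈ D, g z ≠ 0)
    (h : ∀ K ⊆ D, IsCompact K → ∃ f : ℂ → ℂ, ContinuousOn f K ∧ ∀ z ∈ K, Complex.exp (f z) = g z) :
    ∃ f : ℂ → ℂ, ContinuousOn f D ∧ ∀ z ∈ D, Complex.exp (f z) = g z := by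
  obtain ⟨z₀, hz₀⟩ := hc.nonempty
  have hn : ∀ K ⊆ D, IsCompact K → z₀ ∈ K → ∃ f : ℂ → ℂ, ContinuousOn f K ∧
      (∀ z ∈ K, Complex.exp (f z) = g z) ∧ f z₀ = Complex.log (g z₀) := fun K hK hKc hzK => by
    obtain ⟨f, hf, hfg⟩ := h K hK hKc
    refine ⟨fun z => f z + (Complex.log (g z₀) - f z₀), hf.add continuousOn_const,
      fun z hz => ?_, by ring⟩
    rw [Complex.exp_add, Complex.exp_sub, hfg z hz, Complex.exp_log (h0 z₀ hz₀), hfg z₀ hzK,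
      div_self (h0 z₀ hz₀), mul_one]
  have hpath : ∀ z, ∃ K : Set ℂ, z ∈ D → K ⊆ D ∧ IsCompact K ∧ IsPreconnected K ∧ z₀ ∈ K ∧ z ∈ K :=
    fun z => by
      by_cases hz : z ∈ D
      · obtain ⟨γ, hγ⟩ := (ho.isConnected_iff_isPathConnected.1 hc).joinedIn z₀ hz₀ z hz
        exact ⟨range γ, fun _ => ⟨range_subset_iff.2 hγ, isCompact_range γ.continuous,
          isPreconnected_range γ.continuous, ⟨0, γ.source⟩, ⟨1, γ.target⟩⟩⟩
      · exact ⟨∅, fun h => absurd h hz⟩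
  choose K hK using hpath
  have hex : ∀ z, ∃ f : ℂ → ℂ, z ∈ D → ContinuousOn f (K z) ∧
      (∀ w ∈ K z, Complex.exp (f w) = g w) ∧ f z₀ = Complex.log (g z₀) := fun z => by
    by_cases hz : z ∈ D
    · obtain ⟨f, hf⟩ := hn (K z) (hK z hz).1 (hK z hz).2.1 (hK z hz).2.2.2.1
      exact ⟨f, fun _ => hf⟩
    · exact ⟨id, fun h => absurd h hz⟩
  choose F hF using hex
  -- Independence of the connecting set: both logarithms agree with one chosen on the compact union
  -- M ∪ K z, each by connectedness from the common base point z₀. No condition on loops is needed.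
  have huniq : ∀ z ∈ D, ∀ M ⊆ D, IsPreconnected M → z₀ ∈ M → z ∈ M → ∀ f : ℂ → ℂ,
      IsCompact M → ContinuousOn f M → (∀ w ∈ M, Complex.exp (f w) = g w) →
      f z₀ = Complex.log (g z₀) → f z = F z z := by
    intro z hz M hM hMc h0M hzM f hMk hf hfg hf0
    obtain ⟨hKD, hKk, hKc, h0K, hzK⟩ := hK z hz
    obtain ⟨h1, h2, h3⟩ := hF z hz
    obtain ⟨G, hG, hGg, hG0⟩ := hn (M ∪ K z) (union_subset hM hKD) (hMk.union hKk) (Or.inl h0M)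
    have e1 := eqOn_of_exp_eqOn hMc hf (hG.mono subset_union_left)
      (fun w hw => (hfg w hw).trans (hGg w (Or.inl hw)).symm) h0M (hf0.trans hG0.symm)
    have e2 := eqOn_of_exp_eqOn hKc h1 (hG.mono subset_union_right)
      (fun w hw => (h2 w hw).trans (hGg w (Or.inr hw)).symm) h0K (h3.trans hG0.symm)
    exact (e1 hzM).trans (e2 hzK).symm
  refine ⟨fun z => F z z, fun z hz => ?_, fun z hz => (hF z hz).2.1 z (hK z hz).2.2.2.2⟩
  obtain ⟨r, hr, hrD⟩ := nhds_basis_closedBall.mem_iff.1 (ho.mem_nhds hz)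
  obtain ⟨hKD, hKk, hKc, h0K, hzK⟩ := hK z hz
  have hMD : K z ∪ closedBall z r ⊆ D := union_subset hKD hrD
  have hMk : IsCompact (K z ∪ closedBall z r) := hKk.union (isCompact_closedBall z r)
  obtain ⟨f, hf, hfg, hf0⟩ := hn _ hMD hMk (Or.inl h0K)
  have hMc : IsPreconnected (K z ∪ closedBall z r) :=
    hKc.union z hzK (mem_closedBall_self hr.le) (convex_closedBall z r).isPreconnected
  have hfz : ContinuousAt f z :=
    hf.continuousAt (mem_of_superset (closedBall_mem_nhds z hr) subset_union_right)
  refine (hfz.congr ?_).continuousWithinAt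
  filter_upwards [closedBall_mem_nhds z hr] with w hw
  exact huniq w (hrD hw) _ hMD hMc (Or.inl h0K) (Or.inr hw) f hMk hf hfg hf0

/-- The exterior is the exponential image of a half-plane. -/
theorem isPreconnected_le_norm {R : ℝ} (hR : 0 < R) : IsPreconnected {z : ℂ | R ≤ ‖z‖} := by
  have h : {z : ℂ | R ≤ ‖z‖} = Complex.exp '' {z | Real.log R ≤ z.re} := by
    ext z
    constructor
    · intro hz
      have hz0 : 0 < ‖z‖ := hR.trans_le hz
      refine ⟨Complex.log z, ?_, Complex.exp_log (norm_pos_iff.1 hz0)⟩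
      rw [mem_ofPred_eq, Complex.log_re]
      exact Real.log_le_log hR hz
    · rintro ⟨w, hw, rfl⟩
      rw [mem_ofPred_eq, Complex.norm_exp]
      exact (Real.log_le_iff_le_exp hR).1 hw
  rw [h]
  exact (convex_halfSpace_re_ge _).isPreconnected.image _ Complex.continuous_exp.continuousOn

theorem not_isBounded_le_norm (R : ℝ) : ¬ Bornology.IsBounded {z : ℂ | R ≤ ‖z‖} := by
  intro h
  obtain ⟨M, hM⟩ := h.exists_norm_le
  have h1 : ‖((|R| + |M| + 1 : ℝ) : ℂ)‖ = |R| + |M| + 1 := by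
    rw [Complex.norm_real, Real.norm_of_nonneg (by positivity)]
  have h2 := hM ((|R| + |M| + 1 : ℝ) : ℂ) (by
    rw [mem_ofPred_eq, h1]
    linarith [le_abs_self R, abs_nonneg M])
  rw [h1] at h2
  linarith [le_abs_self M, abs_nonneg R]

/-- A planar region has continuous logarithms if its compact subsets do not cut points outside the
region from infinity. -/
theorem hasContLog_of_not_isBounded_components {D : Set ℂ} (ho : IsOpen D) (hc : IsConnected D)
    (h : ∀ K ⊆ D, IsCompact K → ∀ z, z ∉ D →
      ¬ Bornology.IsBounded (connectedComponentIn Kᶜ z)) : HasContLog D := by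
  intro g hg h0
  refine exists_log_of_forall_isCompact ho hc h0 fun K hK hKc => ?_
  -- K with the bounded components of its complement filled in. The hypothesis on D keeps L inside
  -- D, so g is defined and zero-free on L, and the points off L lie in unbounded components.
  set L : Set ℂ := {z | z ∈ Kᶜ → Bornology.IsBounded (connectedComponentIn Kᶜ z)}
  have hKL : K ⊆ L := fun z hz hz' => absurd hz hz'
  have hLD : L ⊆ D := fun z hz => by
    by_contra hzD
    exact h K hK hKc z hzD (hz fun hzK => hzD (hK hzK))
  have hLc : IsClosed L := by
    rw [← isOpen_compl_iff, isOpen_iff_mem_nhds]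
    intro z hz
    simp only [L, mem_compl_iff, mem_ofPred_eq, Classical.not_imp] at hz
    have hmem := mem_connectedComponentIn (F := Kᶜ) hz.1
    filter_upwards [hKc.isClosed.isOpen_compl.connectedComponentIn.mem_nhds hmem] with w hw
    intro hwL
    refine hz.2 ?_
    rw [connectedComponentIn_eq hw]
    exact hwL (connectedComponentIn_subset _ _ hw)
  have hLb : Bornology.IsBounded L := by
    obtain ⟨R, hR, hKR⟩ := hKc.isBounded.subset_ball_lt 0 (0 : ℂ)
    refine (isBounded_ball (x := (0 : ℂ)) (r := R)).subset fun z hz => ?_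
    by_contra hzR
    rw [mem_ball_zero_iff, not_lt] at hzR
    have hsub : {z : ℂ | R ≤ ‖z‖} ⊆ Kᶜ := fun w hw hwK =>
      absurd (mem_ball_zero_iff.1 (hKR hwK)) (not_lt.2 hw)
    exact not_isBounded_le_norm R ((hz (hsub hzR)).subset
      ((isPreconnected_le_norm hR).subset_connectedComponentIn hzR hsub))
  refine exists_log_of_hasLogAt (Metric.isCompact_of_isClosed_isBounded hLc hLb) hKL
    (fun a ha => ?_) (hg.mono hLD) (fun z hz => h0 z (hLD hz))
  simp only [L, mem_ofPred_eq, Classical.not_imp] at ha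
  exact hasLogAt_of_not_isBounded hKc isPreconnected_connectedComponentIn
    (connectedComponentIn_subset _ _) ha.2
    (mem_connectedComponentIn (F := Kᶜ) ha.1)

/-! ### Logarithms force a connected complement. -/

/-- The function `z - p` has no continuous logarithm outside a disc around `p`. -/
theorem not_exists_log_outside {p : ℂ} {R : ℝ} (hR : 0 < R) (hp : ‖p‖ < R) {l : ℂ → ℂ}
    (hl : Continuous l) (h : ∀ z, R ≤ ‖z‖ → Complex.exp (l z) = z - p) : False := by
  -- Such an l would be a primitive of 1/(z - p) along a circle around p, whose integral is 2πi.
  have hder : ∀ z ∈ sphere (0 : ℂ) (2 * R), HasDerivAt l ((z - p)⁻¹) z := fun z hz => by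
    rw [mem_sphere_zero_iff_norm] at hz
    have hev : ∀ᶠ w in 𝓝 z, R < ‖w‖ :=
      continuous_norm.continuousAt.eventually_const_lt (show R < ‖z‖ by rw [hz]; linarith)
    have hadd : HasDerivAt (fun w => l (w + p)) ((Complex.exp (l (z - p + p)))⁻¹) (z - p) := by
      refine HasDerivAt.of_local_left_inverse (f := Complex.exp) (by fun_prop)
        (Complex.hasDerivAt_exp _) (Complex.exp_ne_zero _) ?_
      have hc : ContinuousAt (fun w : ℂ => w + p) (z - p) := by fun_prop
      have hev' : ∀ᶠ w in 𝓝 (z - p + p), R < ‖w‖ := by rwa [sub_add_cancel]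
      filter_upwards [hc.eventually hev'] with w hw
      rw [h _ hw.le, add_sub_cancel_right]
    rw [sub_add_cancel, h z (by rw [hz]; linarith)] at hadd
    have := hadd.comp z ((hasDerivAt_id z).sub_const p)
    simpa [Function.comp_def] using this
  have h1 := circleIntegral.integral_eq_zero_of_hasDerivWithinAt' (f := l)
    (f' := fun z => (z - p)⁻¹) (c := 0) (R := 2 * R)
    fun z hz => (hder z (by rwa [abs_of_pos (by positivity)] at hz)).hasDerivWithinAt
  rw [circleIntegral.integral_sub_inv_of_mem_ball (by rw [mem_ball_zero_iff]; linarith)] at h1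
  exact Complex.two_pi_I_ne_zero h1

/-- For p ∈ P let l be a logarithm of z - p on U. Interpolating by exp((1 - χ) l) between z - p near
Q and 1 near P gives a zero-free continuous function on the plane. Its global logarithm would be a
logarithm of z - p on |z| ≥ 1. -/
theorem eq_empty_of_isClosed_of_hasContLog {U P Q : Set ℂ} (ho : IsOpen U) (hlog : HasContLog U)
    (hP : IsClosed P) (hQ : IsClosed Q) (hPQ : Disjoint P Q) (hU : P ∪ Q = Uᶜ)
    (hdQ : {z : ℂ | 1 ≤ ‖z‖} ⊆ Q) : P = ∅ := by
  by_contra hne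
  obtain ⟨p, hp⟩ := nonempty_iff_ne_empty.2 hne
  have hp1 : ‖p‖ < 1 := by
    by_contra! h
    exact disjoint_left.1 hPQ hp (hdQ h)
  have hpU : ∀ z ∈ U, z - p ≠ 0 := fun z hz h => by
    have : p ∈ Uᶜ := hU ▸ Or.inl hp
    rw [sub_eq_zero] at h
    exact this (h ▸ hz)
  obtain ⟨l, hl, hle⟩ := hlog (fun z => z - p) (by fun_prop) hpU
  obtain ⟨f, hf0, hf1, -⟩ := exists_continuous_zero_one_of_isClosed hQ hP hPQ.symm
  have hfc : Continuous f := f.continuous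
  let χ : ℂ → ℝ := fun z => max 0 (min 1 (3 * f z - 1))
  have hχ : Continuous χ := by fun_prop
  have hχ0 : ∀ z, f z < 1 / 3 → χ z = 0 := fun z hz => by
    have : 3 * f z - 1 ≤ 0 := by linarith
    simp [χ, min_eq_right (this.trans zero_le_one), max_eq_left this]
  have hχ1 : ∀ z, 2 / 3 < f z → χ z = 1 := fun z hz => by
    have : 1 ≤ 3 * f z - 1 := by linarith
    simp [χ, min_eq_left this]
  classical
  let F : ℂ → ℂ := fun z => if f z < 1 / 3 then z - p else if 2 / 3 < f z then 1 else
    Complex.exp ((1 - χ z) * l z)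
  have hFlo : ∀ z, f z < 1 / 3 → F z = z - p := fun z hz => if_pos hz
  have hFhi : ∀ z, 2 / 3 < f z → F z = 1 := fun z hz => by
    have : ¬ f z < 1 / 3 := by linarith
    simp only [F, if_neg this, if_pos hz]
  have hFU : ∀ z ∈ U, F z = Complex.exp ((1 - χ z) * l z) := fun z hz => by
    by_cases h1 : f z < 1 / 3
    · rw [hFlo z h1, hχ0 z h1, Complex.ofReal_zero, sub_zero, one_mul, hle z hz]
    · by_cases h2 : 2 / 3 < f z
      · rw [hFhi z h2, hχ1 z h2]
        simp
      · simp only [F, if_neg h1, if_neg h2]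
  have hmid : ∀ z, ¬ f z < 1 / 3 → ¬ 2 / 3 < f z → z ∈ U := fun z h1 h2 => by
    by_contra hz
    have hz' : z ∈ P ∪ Q := hU ▸ hz
    rcases hz' with h | h
    · exact h2 (by rw [hf1 h]; norm_num)
    · exact h1 (by rw [hf0 h]; norm_num)
  have hFc : Continuous F := continuous_iff_continuousAt.2 fun z => by
    by_cases h1 : f z < 1 / 3
    · refine (show ContinuousAt (fun z => z - p) z by fun_prop).congr ?_
      filter_upwards [hfc.continuousAt.eventually_lt_const h1] with w hw using (hFlo w hw).symm
    by_cases h2 : 2 / 3 < f z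
    · refine (continuousAt_const (y := (1 : ℂ))).congr ?_
      filter_upwards [hfc.continuousAt.eventually_const_lt h2] with w hw using (hFhi w hw).symm
    have hzU := hmid z h1 h2
    refine ContinuousAt.congr (f := fun z => Complex.exp ((1 - χ z) * l z)) ?_ ?_
    · exact ((continuousAt_const.sub (Complex.continuous_ofReal.comp hχ).continuousAt).mul
        (hl.continuousAt (ho.mem_nhds hzU))).cexp
    · filter_upwards [ho.mem_nhds hzU] with w hw using (hFU w hw).symm
  have hF0 : ∀ z, F z ≠ 0 := fun z => by
    by_cases h1 : f z < 1 / 3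
    · rw [hFlo z h1, sub_ne_zero]
      rintro rfl
      rw [hf1 hp] at h1
      norm_num at h1
    by_cases h2 : 2 / 3 < f z
    · rw [hFhi z h2]
      exact one_ne_zero
    · rw [hFU z (hmid z h1 h2)]
      exact Complex.exp_ne_zero _
  obtain ⟨m, hm, hmF⟩ := (isSimplyConnectedRegion_of_convex isOpen_univ convex_univ
    ⟨(0 : ℂ), mem_univ _⟩).hasContLog F hFc.continuousOn (fun z _ => hF0 z)
  refine not_exists_log_outside one_pos hp1 (continuousOn_univ.1 hm) fun z hz => ?_
  rw [hmF z (mem_univ z), hFlo z (by rw [hf0 (hdQ hz)]; norm_num)]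

/-- In a separation of the complement the connected exterior |z| ≥ 1 lies in one piece, so the other
piece is empty. -/
theorem isPreconnected_compl_of_hasContLog {U : Set ℂ} (ho : IsOpen U) (hU : U ⊆ disc)
    (hlog : HasContLog U) : IsPreconnected Uᶜ := by
  rw [isPreconnected_iff_subset_of_disjoint_closed]
  have hout : {z : ℂ | 1 ≤ ‖z‖} ⊆ Uᶜ := fun z hz hzU =>
    absurd (mem_ball_zero_iff.1 (hU hzU)) (not_lt.2 hz)
  have key : ∀ u v : Set ℂ, IsClosed u → IsClosed v → Uᶜ ⊆ u ∪ v → Uᶜ ∩ (u ∩ v) = ∅ →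
      {z : ℂ | 1 ≤ ‖z‖} ⊆ v → Uᶜ ⊆ v := by
    intro u v hu hv hcov hdis hout'
    have hP := eq_empty_of_isClosed_of_hasContLog ho hlog (P := Uᶜ ∩ u) (Q := Uᶜ ∩ v)
      (ho.isClosed_compl.inter hu) (ho.isClosed_compl.inter hv)
      (disjoint_left.2 fun z h1 h2 => by
        have : z ∈ Uᶜ ∩ (u ∩ v) := ⟨h1.1, h1.2, h2.2⟩
        rwa [hdis] at this)
      (by rw [← inter_union_distrib_left, inter_eq_left.2 hcov]) (subset_inter hout hout')
    intro z hz
    refine (hcov hz).resolve_left fun hzu => ?_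
    have : z ∈ Uᶜ ∩ u := ⟨hz, hzu⟩
    rwa [hP] at this
  intro u v hu hv hcov hdis
  rcases isPreconnected_iff_subset_of_disjoint_closed.1
    (isPreconnected_le_norm one_pos) u v hu hv
    (hout.trans hcov) (by
      rw [← subset_empty_iff, ← hdis]
      exact inter_subset_inter_left _ hout) with h | h
  · exact Or.inl (key v u hv hu (by rwa [union_comm]) (by rwa [inter_comm v u]) h)
  · exact Or.inr (key u v hu hv hcov hdis h)

/-! ### The hyperbolic neighbourhood: closedness and connectedness. -/

theorem one_sub_norm_sq_pos {z : ℂ} (hz : ‖z‖ < 1) : 0 < 1 - ‖z‖ ^ 2 := by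
  nlinarith [norm_nonneg z]

theorem hypDist_le_iff {z w : ℂ} (hz : ‖z‖ < 1) (hw : ‖w‖ < 1) {t : ℝ} (ht : 0 ≤ t) :
    hypDist z w ≤ 2 * Real.arsinh t ↔ ‖z - w‖ ^ 2 ≤ t ^ 2 * ((1 - ‖z‖ ^ 2) * (1 - ‖w‖ ^ 2)) := by
  have hc : 0 < (1 - ‖z‖ ^ 2) * (1 - ‖w‖ ^ 2) :=
    mul_pos (one_sub_norm_sq_pos hz) (one_sub_norm_sq_pos hw)
  rw [hypDist, mul_le_mul_iff_right₀ two_pos, Real.arsinh_le_arsinh,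
    div_le_iff₀ (Real.sqrt_pos.2 hc), ← abs_of_nonneg (norm_nonneg (z - w)),
    ← abs_of_nonneg (mul_nonneg ht (Real.sqrt_nonneg _)), ← sq_le_sq, mul_pow, Real.sq_sqrt hc.le, abs_norm]

/-- The relation `dist_hyp (z, b) ≤ 1`, in polynomial form. -/
def HypNear (z b : ℂ) : Prop :=
  ‖z - b‖ ^ 2 ≤ Real.sinh (1 / 2) ^ 2 * ((1 - ‖z‖ ^ 2) * (1 - ‖b‖ ^ 2))

theorem sinh_half_pos : 0 < Real.sinh (1 / 2) := Real.sinh_pos_iff.2 (by norm_num)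

theorem one_eq_two_mul_arsinh : (1 : ℝ) = 2 * Real.arsinh (Real.sinh (1 / 2)) := by
  rw [Real.arsinh_sinh]
  norm_num

theorem HypNear.norm_lt_one {z b : ℂ} (h : HypNear z b) (hz : ‖z‖ < 1) (hb : ‖b‖ ≤ 1) :
    ‖b‖ < 1 := by
  refine hb.lt_of_ne fun hb1 => ?_
  rw [HypNear, hb1] at h
  have h1 : ‖z - b‖ = 0 := by nlinarith [norm_nonneg (z - b)]
  rw [norm_eq_zero, sub_eq_zero] at h1
  rw [h1] at hz
  linarith

theorem hypNear_self {b : ℂ} : HypNear b b := by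
  rw [HypNear, sub_self, norm_zero]
  have := mul_self_nonneg (1 - ‖b‖ ^ 2)
  have := sq_nonneg (Real.sinh (1 / 2))
  rw [zero_pow two_ne_zero]
  positivity

/-- The complement of a relatively closed subset `B` of the disc, together with the
exterior of the disc. -/
theorem compl_disc_diff (B : Set ℂ) : (disc \ B)ᶜ = B ∪ {z | 1 ≤ ‖z‖} := by
  ext z
  simp only [mem_compl_iff, Set.mem_sdiff, mem_ball_zero_iff, mem_union, mem_ofPred_eq, not_and, not_not]
  constructor
  · intro h
    by_cases hz : ‖z‖ < 1
    · exact Or.inl (h hz)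
    · exact Or.inr (not_lt.1 hz)
  · rintro (h | h) h'
    · exact h
    · linarith

theorem isCompact_closedBall_diff {B : Set ℂ} (ho : IsOpen (disc \ B)) :
    IsCompact (closedBall (0 : ℂ) 1 \ (disc \ B)) :=
  (isCompact_closedBall 0 1).diff ho

theorem mem_of_mem_closedBall_diff {B : Set ℂ} {b : ℂ}
    (hb : b ∈ closedBall (0 : ℂ) 1 \ (disc \ B)) (h1 : ‖b‖ < 1) : b ∈ B := by
  by_contra h
  exact hb.2 ⟨mem_ball_zero_iff.2 h1, h⟩

/-- The infimum defining the distance is attained: the polynomial defect is minimised over the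
compact set B ∪ {|b| = 1}, and points of the circle are never near z. The circle also makes this set
nonempty when B = ∅. -/
theorem mem_hypNhd_iff {B : Set ℂ} (hB : B ⊆ disc) (ho : IsOpen (disc \ B)) {z : ℂ} :
    z ∈ hypNhd B ↔ z ∈ disc ∧ ∃ b ∈ B, HypNear z b := by
  refine and_congr_right fun hz => ?_
  have hz1 := mem_ball_zero_iff.1 hz
  have hs := sinh_half_pos
  constructor
  · intro hinf
    have hk : Continuous fun b : ℂ => ‖z - b‖ ^ 2 -
        Real.sinh (1 / 2) ^ 2 * ((1 - ‖z‖ ^ 2) * (1 - ‖b‖ ^ 2)) := by fun_prop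
    obtain ⟨b, hb, hmin⟩ := (isCompact_closedBall_diff ho).exists_isMinOn
      ⟨1, by simp, fun h => by simpa using h.1⟩ hk.continuousOn
    have hb1 : ‖b‖ ≤ 1 := mem_closedBall_zero_iff.1 hb.1
    by_cases hle : HypNear z b
    · exact ⟨b, mem_of_mem_closedBall_diff hb (hle.norm_lt_one hz1 hb1), hle⟩
    exfalso
    rw [HypNear, not_le, ← sub_pos] at hle
    set m := ‖z - b‖ ^ 2 - Real.sinh (1 / 2) ^ 2 * ((1 - ‖z‖ ^ 2) * (1 - ‖b‖ ^ 2))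
    -- With minimal defect m > 0, a distance at most 2 arsinh t would give m ≤ (m/2)(1 - |z|²)(1 -
    -- |c|²) ≤ m/2. So all distances exceed a fixed number greater than 1.
    set t := √(Real.sinh (1 / 2) ^ 2 + m / 2)
    have ht : Real.sinh (1 / 2) < t := Real.lt_sqrt_of_sq_lt (by linarith)
    have ht2 : t ^ 2 = Real.sinh (1 / 2) ^ 2 + m / 2 := Real.sq_sqrt (by positivity)
    have hlt : 1 < 2 * Real.arsinh t := by
      have := Real.arsinh_lt_arsinh.2 ht
      linarith [one_eq_two_mul_arsinh]
    have hinf' : ENNReal.ofReal (2 * Real.arsinh t) ≤ hypInfDist z B := by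
      refine le_iInf₂ fun c hc => ENNReal.ofReal_le_ofReal ?_
      have hc1 := mem_ball_zero_iff.1 (hB hc)
      by_contra! hcon
      have h1 := (hypDist_le_iff hz1 hc1 (hs.trans ht).le).1 hcon.le
      have h2 : m ≤ ‖z - c‖ ^ 2 - Real.sinh (1 / 2) ^ 2 * ((1 - ‖z‖ ^ 2) * (1 - ‖c‖ ^ 2)) :=
        hmin ⟨ball_subset_closedBall (hB hc), fun h => h.2 hc⟩
      rw [ht2] at h1
      have hc0 : (1 - ‖z‖ ^ 2) * (1 - ‖c‖ ^ 2) ≤ 1 := by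
        have := one_sub_norm_sq_pos hz1
        have := one_sub_norm_sq_pos hc1
        nlinarith [sq_nonneg ‖z‖, sq_nonneg ‖c‖]
      nlinarith
    have := hinf'.trans hinf
    rw [ENNReal.ofReal_le_one] at this
    linarith
  · rintro ⟨b, hb, hzb⟩
    refine (iInf₂_le b hb).trans ?_
    rw [ENNReal.ofReal_le_one, one_eq_two_mul_arsinh,
      hypDist_le_iff hz1 (mem_ball_zero_iff.1 (hB hb)) hs.le]
    exact hzb

/-- Up to the exterior, N(B) is the projection of a compact set of near pairs; the limit points b on
the unit circle only contribute points of the exterior. -/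
theorem isClosed_hypNhd_union {B : Set ℂ} (hB : B ⊆ disc) (ho : IsOpen (disc \ B)) :
    IsClosed (hypNhd B ∪ {z | 1 ≤ ‖z‖}) := by
  have hC := (isCompact_closedBall (0 : ℂ) 1).prod (isCompact_closedBall_diff ho)
  have hS : IsClosed {x : ℂ × ℂ | HypNear x.1 x.2} :=
    isClosed_le (by fun_prop) (by fun_prop)
  have himg := ((hC.inter_right hS).image continuous_fst).isClosed
  have hcl : IsClosed {z : ℂ | 1 ≤ ‖z‖} := isClosed_le continuous_const continuous_norm
  convert himg.union hcl using 1
  ext z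
  simp only [mem_union, mem_hypNhd_iff hB ho, mem_image, Prod.exists, exists_and_right,
    exists_eq_right, mem_inter_iff, mem_prod, mem_ofPred_eq]
  constructor
  · rintro (⟨hz, b, hb, hzb⟩ | h)
    · exact Or.inl ⟨b, ⟨ball_subset_closedBall hz, ball_subset_closedBall (hB hb),
        fun h => h.2 hb⟩, hzb⟩
    · exact Or.inr h
  · rintro (⟨b, ⟨hz, hb⟩, hzb⟩ | h)
    · by_cases hz1 : ‖z‖ < 1
      · exact Or.inl ⟨mem_ball_zero_iff.2 hz1, b, mem_of_mem_closedBall_diff hb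
          (HypNear.norm_lt_one hzb hz1 (mem_closedBall_zero_iff.1 hb.1)), hzb⟩
      · exact Or.inr (not_lt.1 hz1)
    · exact Or.inr h

/-- This is a sublevel set of the convex function |z - b|² + κ|z|². -/
theorem convex_hypNear {b : ℂ} (hb : ‖b‖ < 1) : Convex ℝ {z | HypNear z b} := by
  set κ := Real.sinh (1 / 2) ^ 2 * (1 - ‖b‖ ^ 2)
  have hκ : 0 ≤ κ := mul_nonneg (sq_nonneg _) (one_sub_norm_sq_pos hb).le
  have h1 : ConvexOn ℝ univ fun z : ℂ => dist z b ^ 2 :=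
    (convexOn_univ_dist b).pow (fun _ _ => dist_nonneg) 2
  have h2 : ConvexOn ℝ univ fun z : ℂ => ‖z‖ ^ 2 :=
    convexOn_univ_norm.pow (fun _ _ => norm_nonneg _) 2
  convert (h1.add (h2.smul hκ)).convex_le κ using 1
  ext z
  simp only [HypNear, mem_ofPred_eq, mem_univ, true_and, Pi.add_apply, smul_eq_mul, dist_eq_norm]
  constructor <;> intro h <;> linarith [show Real.sinh (1 / 2) ^ 2 * ((1 - ‖z‖ ^ 2) *
    (1 - ‖b‖ ^ 2)) = κ - κ * ‖z‖ ^ 2 by ring]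

/-- A convex hyperbolic disc ties each point of N(B) to a point of B, hence to the connected set B ∪
{|z| ≥ 1}. -/
theorem isPreconnected_hypNhd_union {B : Set ℂ} (hB : B ⊆ disc) (ho : IsOpen (disc \ B))
    (hc : IsPreconnected (disc \ B)ᶜ) : IsPreconnected (hypNhd B ∪ {z | 1 ≤ ‖z‖}) := by
  rw [compl_disc_diff B] at hc
  have hsub : B ∪ {z : ℂ | 1 ≤ ‖z‖} ⊆ hypNhd B ∪ {z | 1 ≤ ‖z‖} :=
    union_subset_union_left _ fun b hb => (mem_hypNhd_iff hB ho).2 ⟨hB hb, b, hb, hypNear_self⟩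
  refine isPreconnected_of_forall (1 : ℂ) fun z hz => ?_
  rcases hz with hz | hz
  · obtain ⟨-, b, hb, hzb⟩ := (mem_hypNhd_iff hB ho).1 hz
    refine ⟨(B ∪ {z : ℂ | 1 ≤ ‖z‖}) ∪ {z | HypNear z b}, union_subset hsub fun w hw => ?_,
      Or.inl (Or.inr (by simp)), Or.inr hzb, hc.union b (Or.inl hb) hypNear_self
        (convex_hypNear (mem_ball_zero_iff.1 (hB hb))).isPreconnected⟩
    by_cases hw1 : ‖w‖ < 1
    · exact Or.inl ((mem_hypNhd_iff hB ho).2 ⟨mem_ball_zero_iff.2 hw1, b, hb, hw⟩)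
    · exact Or.inr (not_lt.1 hw1)
  · exact ⟨_, hsub, Or.inr (by simp), Or.inr hz, hc⟩

/-! ### The component of 0 and the filled neighbourhood. -/

theorem frontier_connectedComponentIn_subset {E : Set ℂ} (hE : IsClosed E) (x : ℂ) :
    frontier (connectedComponentIn Eᶜ x) ⊆ E := by
  intro p hp
  by_contra hpE
  have hmem := mem_connectedComponentIn (F := Eᶜ) hpE
  obtain ⟨w, hwp, hwx⟩ := mem_closure_iff_nhds.1 (frontier_subset_closure hp) _
    (hE.isOpen_compl.connectedComponentIn.mem_nhds hmem)
  rw [hE.isOpen_compl.connectedComponentIn.frontier_eq] at hp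
  refine hp.2 ?_
  rwa [(connectedComponentIn_eq hwx).trans (connectedComponentIn_eq hwp).symm]

/-- The components of the complement of an unbounded connected closed set have connected
complement, in the form needed here. -/
theorem not_isBounded_connectedComponentIn {E K : Set ℂ} (hE : IsClosed E)
    (hEc : IsPreconnected E) (hEb : ¬ Bornology.IsBounded E) {x z : ℂ}
    (hK : K ⊆ connectedComponentIn Eᶜ x) (hz : z ∉ connectedComponentIn Eᶜ x) :
    ¬ Bornology.IsBounded (connectedComponentIn Kᶜ z) := by
  have hEK : E ⊆ Kᶜ := fun w hw hwK => connectedComponentIn_subset _ _ (hK hwK) hw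
  have hzK : z ∈ Kᶜ := fun h => hz (hK h)
  have key : ∀ w ∈ E, w ∈ connectedComponentIn Kᶜ z →
      ¬ Bornology.IsBounded (connectedComponentIn Kᶜ z) := fun w hw hwz hb => by
    rw [connectedComponentIn_eq hwz] at hb
    exact hEb (hb.subset (hEc.subset_connectedComponentIn hw hEK))
  by_cases hzE : z ∈ E
  · exact key z hzE (mem_connectedComponentIn hzK)
  have hzE' : z ∈ Eᶜ := hzE
  set W := connectedComponentIn Eᶜ z
  have hzW : z ∈ W := mem_connectedComponentIn hzE'
  have hWc : IsPreconnected W := isPreconnected_connectedComponentIn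
  have hWK : W ⊆ Kᶜ := fun w hw hwK => hz <| by
    rw [connectedComponentIn_eq (hK hwK), ← connectedComponentIn_eq hw]
    exact hzW
  have hEne : E.Nonempty := nonempty_iff_ne_empty.2 fun h => hEb (h ▸ Bornology.isBounded_empty)
  obtain ⟨e, he⟩ := hEne
  -- The component W of z off E has a frontier point p in E, and W ∪ {p} is connected and misses K.
  -- So z is joined off K to the unbounded set E.
  obtain ⟨p, hp⟩ := nonempty_frontier_iff.2 ⟨⟨z, hzW⟩, fun h : W = univ =>
    (connectedComponentIn_subset Eᶜ z) (h ▸ mem_univ e : e ∈ W) he⟩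
  have hpE : p ∈ E := frontier_connectedComponentIn_subset hE z hp
  have hWp : IsPreconnected (insert p W) := hWc.subset_closure (subset_insert p W)
    (insert_subset (frontier_subset_closure hp) subset_closure)
  exact key p hpE (hWp.subset_connectedComponentIn (mem_insert_of_mem p hzW)
    (insert_subset (hEK hpE) hWK) (mem_insert p W))

/-- Filling discards every component except that of 0, so the topology of E determines the set in
the theorem. -/
theorem disc_diff_filledHypNhd {B : Set ℂ} (h0 : 0 ∉ hypNhd B) :
    disc \ filledHypNhd B = connectedComponentIn (hypNhd B ∪ {z | 1 ≤ ‖z‖})ᶜ 0 := by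
  have hD : (hypNhd B ∪ {z | 1 ≤ ‖z‖})ᶜ = disc \ hypNhd B := by
    ext z
    simp [and_comm]
  rw [hD]
  have hmem0 : (0 : ℂ) ∈ disc \ hypNhd B := ⟨by simp, h0⟩
  ext z
  constructor
  · rintro ⟨hz, hzf⟩
    have hzN : z ∈ disc \ hypNhd B := ⟨hz, fun h => hzf (Or.inl h)⟩
    have h0z : (0 : ℂ) ∈ connectedComponentIn (disc \ hypNhd B) z := by
      by_contra h
      exact hzf (Or.inr ⟨_, ⟨⟨z, hzN, rfl⟩, h⟩, mem_connectedComponentIn hzN⟩)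
    rw [← connectedComponentIn_eq h0z]
    exact mem_connectedComponentIn hzN
  · intro hz
    have hzN := connectedComponentIn_subset _ _ hz
    refine ⟨hzN.1, ?_⟩
    rintro (h | ⟨_, ⟨⟨w, hw, rfl⟩, h0w⟩, hzw⟩)
    · exact hzN.2 h
    · refine h0w ?_
      rw [connectedComponentIn_eq hzw, ← connectedComponentIn_eq hz]
      exact mem_connectedComponentIn hmem0

/-! ### The Schwarz lemma estimate near an omitted point. -/

theorem sinh_half_sq_le : Real.sinh (1 / 2) ^ 2 ≤ 28 / 100 := by
  have h1 : Real.exp (1 / 2) ^ 2 = Real.exp 1 := by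
    rw [← Real.exp_nat_mul]
    norm_num
  have h2 : Real.exp (1 / 2) * Real.exp (-(1 / 2)) = 1 := by
    rw [← Real.exp_add]
    norm_num
  have h3 : Real.exp (-(1 / 2)) ^ 2 * Real.exp 1 = 1 := by rw [← h1, ← mul_pow, mul_comm, h2, one_pow]
  have h4 := Real.exp_one_lt_d9
  have h5 := Real.exp_one_gt_d9
  have h6 : Real.exp (-(1 / 2)) ^ 2 ≤ 0.38 := by nlinarith [sq_nonneg (Real.exp (-(1 / 2)))]
  have h7 : Real.sinh (1 / 2) ^ 2 = (Real.exp (1 / 2) ^ 2 + Real.exp (-(1 / 2)) ^ 2 - 2) / 4 := by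
    rw [Real.sinh_eq]
    linear_combination (-1 / 2) * h2
  rw [h7, h1]
  norm_num at h4 h6 ⊢
  linarith

/-- The squared pseudo-hyperbolic distance is at most s/(1 + s) with s = sinh²(1/2) ≤ 0.28, and
0.28/1.28 < 0.47². -/
theorem HypNear.norm_sub_le_mul {z b : ℂ} (h : HypNear z b) :
    ‖z - b‖ ≤ 47 / 100 * ‖1 - conj b * z‖ := by
  have h1 := normSq_one_sub_conj_mul b z
  have h2 := sinh_half_sq_le
  rw [HypNear] at h
  refine abs_le_of_sq_le_sq' ?_ (by positivity) |>.2
  have h3 := sq_nonneg (Real.sinh (1 / 2))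
  set s := Real.sinh (1 / 2) ^ 2
  set c := (1 - ‖z‖ ^ 2) * (1 - ‖b‖ ^ 2)
  have h4 : ‖1 - conj b * z‖ ^ 2 = ‖z - b‖ ^ 2 + c := by rw [h1]; ring
  have h5 : 0 ≤ ‖z - b‖ ^ 2 := sq_nonneg _
  rcases le_or_gt 0 c with hc | hc
  · nlinarith
  · nlinarith

/-- From |b| - |z| ≤ 0.47 (1 + |z|) and |b| > 1/2 one gets |z| ≥ 0.03/1.47. This both keeps 0 out of
N(B) and fixes the exponent. -/
theorem HypNear.le_norm {z b : ℂ} (h : HypNear z b) (hb : 1 / 2 < ‖b‖) (hb1 : ‖b‖ < 1) :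
    1 / 50 ≤ ‖z‖ := by
  have h1 := h.norm_sub_le_mul
  have h2 : ‖1 - conj b * z‖ ≤ 1 + ‖z‖ := by
    refine (norm_sub_le _ _).trans ?_
    rw [norm_one, norm_mul, Complex.norm_conj]
    nlinarith [norm_nonneg z]
  have h3 := norm_sub_norm_le b z
  rw [norm_sub_rev] at h3
  linarith

/-- With u = κ(1 - X), Bernoulli gives (1 - u)^n ≤ 1/(1 + n u) ≤ X once nκX ≥ 1; the last factor y/X
then turns X into y. -/
theorem div_pow_le_of_le {y X κ : ℝ} {n : ℕ} (hy : 0 < y) (hX0 : 0 < X) (hX : X ≤ 1) (hκ0 : 0 ≤ κ)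
    (hκ : κ ≤ 1) (hyX : y ≤ X * (1 - κ * (1 - X))) (hn : 1 ≤ n * (κ * X)) :
    (y / X) ^ (n + 1) ≤ y := by
  set u := κ * (1 - X)
  have hu0 : 0 ≤ u := mul_nonneg hκ0 (by linarith)
  have hu1 : u ≤ 1 := mul_le_one₀ hκ (by linarith) (by linarith)
  have hδ : y / X ≤ 1 - u := (div_le_iff₀' hX0).2 hyX
  have hδ0 : 0 ≤ y / X := by positivity
  have h1 : 1 + n * u ≤ (1 + u) ^ n := one_add_mul_le_pow (by linarith) n
  have h2 : (1 - u) ^ n * (1 + u) ^ n ≤ 1 := by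
    rw [← mul_pow]
    exact pow_le_one₀ (by nlinarith) (by nlinarith)
  have h3 : 0 ≤ (1 - u) ^ n := pow_nonneg (by linarith) n
  have h4 : 1 ≤ X * (1 + n * u) := by
    have : n * (κ * X) * (1 - X) = X * (n * u) := by ring
    nlinarith
  have h5 : (1 - u) ^ n ≤ X := by
    have h6 : (1 - u) ^ n * (1 + n * u) ≤ 1 := (mul_le_mul_of_nonneg_left h1 h3).trans h2
    have h7 : 0 < 1 + n * u := by positivity
    nlinarith
  calc (y / X) ^ (n + 1) = (y / X) ^ n * (y / X) := pow_succ _ _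
    _ ≤ X * (y / X) := by
      gcongr
      exact (pow_le_pow_left₀ hδ0 hδ n).trans h5
    _ = y := mul_div_cancel₀ y hX0.ne'

theorem mob_neg_mob {a z : ℂ} (ha : ‖a‖ < 1) (hz : ‖z‖ < 1) : mob (-a) (mob a z) = z := by
  have h1 := one_sub_conj_mul_ne_zero ha hz.le
  have h2 := one_sub_conj_mul_ne_zero ha ha.le
  have h3 : mob a z + a = z * (1 - conj a * a) / (1 - conj a * z) := by
    rw [mob, div_add' _ _ _ h1]
    congr 1
    ring
  have h4 : 1 + conj a * mob a z = (1 - conj a * a) / (1 - conj a * z) := by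
    rw [mob, ← mul_div_assoc, add_div' _ _ _ h1]
    congr 1
    ring
  rw [mob, map_neg, neg_mul, sub_neg_eq_add, sub_neg_eq_add, h3, h4,
    div_div_div_cancel_right₀ h1, mul_div_cancel_right₀ _ h2]

/-- Differences of squares factor in numerator and denominator. The squaring map thus becomes a
product of two disc automorphisms. -/
theorem mob_sq (p q : ℂ) : mob (p ^ 2) (q ^ 2) = mob p q * mob (-p) q := by
  rw [mob, mob, mob, div_mul_div_comm, map_pow, map_neg]
  congr 1 <;> ring

/-- Comparison of the pseudo-hyperbolic distances of `q` to `p` and to `-p`. -/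
theorem one_sub_norm_mob_neg_ge {p q : ℂ} (hp : ‖p‖ < 1) (hq : ‖q‖ ≤ 69 / 100) :
    1 / 30 * (1 - ‖mob p q‖ ^ 2) ≤ 1 - ‖mob (-p) q‖ ^ 2 := by
  have hq1 : ‖q‖ ≤ 1 := by linarith
  have hp' : ‖-p‖ < 1 := by rwa [norm_neg]
  have hpq : ‖conj p * q‖ ≤ 69 / 100 := by
    rw [norm_mul, Complex.norm_conj]
    nlinarith [norm_nonneg p, norm_nonneg q]
  have h1 : 31 / 100 ≤ ‖1 - conj p * q‖ := by
    have := norm_sub_norm_le 1 (conj p * q)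
    rw [norm_one] at this
    linarith
  have h2 : ‖1 - conj (-p) * q‖ ≤ 169 / 100 := by
    have := norm_sub_le 1 (conj (-p) * q)
    rw [norm_one, map_neg, neg_mul, norm_neg] at this
    rw [map_neg, neg_mul]
    linarith
  have h3 : 0 < ‖1 - conj (-p) * q‖ := norm_pos_iff.2 (one_sub_conj_mul_ne_zero hp' hq1)
  rw [one_sub_norm_mob_sq hp hq1, one_sub_norm_mob_sq hp' hq1, norm_neg]
  set N := (1 - ‖p‖ ^ 2) * (1 - ‖q‖ ^ 2)
  have hN : 0 ≤ N := mul_nonneg (one_sub_norm_sq_pos hp).le (by nlinarith [norm_nonneg q])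
  rw [← mul_div_assoc, div_le_div_iff₀ (by positivity) (by positivity)]
  -- The constant comes from (169/31)² < 30.
  have h4 : 1 / 30 * ‖1 - conj (-p) * q‖ ^ 2 ≤ ‖1 - conj p * q‖ ^ 2 := by nlinarith
  calc 1 / 30 * N * ‖1 - conj (-p) * q‖ ^ 2 = N * (1 / 30 * ‖1 - conj (-p) * q‖ ^ 2) := by ring
    _ ≤ N * ‖1 - conj p * q‖ ^ 2 := by gcongr

/-- A conformal map onto a region which omits a point at hyperbolic distance at most one from
`φ v` moves `v` definitely towards the origin. -/
theorem norm_div_pow_le {φ : ℂ → ℂ} {b v : ℂ} (hφ : DifferentiableOn ℂ φ disc)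
    (hm : MapsTo φ disc disc) (h0 : φ 0 = 0) (hb : 1 / 2 < ‖b‖) (hb1 : ‖b‖ < 1)
    (hφb : ∀ w ∈ disc, φ w ≠ b) (hv : v ∈ disc) (hnear : HypNear (φ v) b) :
    (‖φ v‖ / ‖v‖) ^ (75000 + 1) ≤ ‖φ v‖ := by
  have hφ1 : ∀ w ∈ disc, ‖φ w‖ < 1 := fun w hw => mem_ball_zero_iff.1 (hm hw)
  have mem0 : (0 : ℂ) ∈ disc := by simp
  obtain ⟨s, ds, hs⟩ := isSimplyConnectedRegion_disc.hasContLog.exists_sqrt isOpen_ball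
    (m := fun w => mob b (φ w)) ((differentiableOn_mob hb1).comp hφ hm)
    (fun w hw h => hφb w hw ((mob_eq_zero_iff hb1 (hφ1 w hw)).1 h))
  have hs1 : ∀ w ∈ disc, ‖s w‖ < 1 := fun w hw => by
    have h1 := norm_mob_lt_one hb1 (hφ1 w hw)
    rw [← hs w hw, norm_pow] at h1
    nlinarith [norm_nonneg (s w)]
  have hsm : MapsTo s disc disc := fun w hw => mem_ball_zero_iff.2 (hs1 w hw)
  -- Schwarz is applied to the square root, recentred to fix 0, rather than to φ itself; this is
  -- where the omitted value b is exploited.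
  have hschwarz : ‖mob (s 0) (s v)‖ ≤ ‖v‖ :=
    Complex.norm_le_norm_of_mapsTo_ball (f := fun w => mob (s 0) (s w)) (R := 1)
      ((differentiableOn_mob (hs1 0 mem0)).comp ds hsm)
      (((mapsTo_mob (hs1 0 mem0)).comp hsm).mono_right ball_subset_closedBall) (by simp)
      (mem_ball_zero_iff.1 hv)
  -- Since s(0)² = -b, undoing the automorphism that moves b to 0 is `mob (s 0 ^ 2)` applied to
  -- s(v)².
  have hz : φ v = mob (s 0) (s v) * mob (-s 0) (s v) := by
    rw [← mob_sq, hs 0 mem0, hs v hv, h0, mob_zero_right, mob_neg_mob hb1 (hφ1 v hv)]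
  have hq : ‖s v‖ ≤ 69 / 100 := by
    have h1 : ‖s v‖ ^ 2 ≤ 47 / 100 := by
      rw [← norm_pow, hs v hv, mob, norm_div,
        div_le_iff₀ (norm_pos_iff.2 (one_sub_conj_mul_ne_zero hb1 (hφ1 v hv).le))]
      exact hnear.norm_sub_le_mul
    nlinarith [norm_nonneg (s v)]
  have hρ := one_sub_norm_mob_neg_ge (hs1 0 mem0) hq
  have hz50 := hnear.le_norm hb hb1
  set t := ‖mob (s 0) (s v)‖
  have ht0 : 0 ≤ t := norm_nonneg _
  have hv1 : ‖v‖ < 1 := mem_ball_zero_iff.1 hv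
  have hX1 : ‖v‖ ^ 2 ≤ 1 := by nlinarith [norm_nonneg v]
  have htX : t ^ 2 ≤ ‖v‖ ^ 2 := pow_le_pow_left₀ ht0 hschwarz 2
  have hyX : ‖φ v‖ ^ 2 ≤ ‖v‖ ^ 2 * (1 - 1 / 30 * (1 - ‖v‖ ^ 2)) := by
    rw [hz, norm_mul, mul_pow]
    calc t ^ 2 * ‖mob (-s 0) (s v)‖ ^ 2 ≤ t ^ 2 * (1 - 1 / 30 * (1 - t ^ 2)) := by
          gcongr
          linarith
      _ ≤ ‖v‖ ^ 2 * (1 - 1 / 30 * (1 - ‖v‖ ^ 2)) := by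
          have : 0 ≤ t ^ 2 := sq_nonneg t
          gcongr
          linarith
  have hy : (1 / 50) ^ 2 ≤ ‖φ v‖ ^ 2 := pow_le_pow_left₀ (by norm_num) hz50 2
  have hyX' : ‖φ v‖ ^ 2 ≤ ‖v‖ ^ 2 := hyX.trans (mul_le_of_le_one_right (sq_nonneg _) (by linarith))
  -- Here X = |v|² ≥ |φ v|² ≥ 1/2500 and κ = 1/30, so n = 75000 is what nκX ≥ 1 requires.
  have key := div_pow_le_of_le (n := 75000) (κ := 1 / 30) (by linarith : 0 < ‖φ v‖ ^ 2)
    (by linarith) hX1 (by norm_num) (by norm_num) hyX (by push_cast; linarith)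
  rw [← div_pow, ← pow_mul, mul_comm 2, pow_mul] at key
  exact (abs_le_of_sq_le_sq' key (norm_nonneg _)).2

/-! ### The maximum principle and the comparison of conformal radii. -/

/-- The maximum modulus principle with boundary values in the sense of the upper limit. -/
theorem norm_le_one_of_frontier {D : Set ℂ} (ho : IsOpen D) (hc : IsPreconnected D)
    (hb : Bornology.IsBounded D) {q : ℂ → ℂ} (hq : DifferentiableOn ℂ q D)
    (hfr : ∀ p ∈ frontier D, ∀ ε > 0, ∀ᶠ z in 𝓝[D] p, ‖q z‖ ≤ 1 + ε) {z₀ : ℂ} (hz₀ : z₀ ∈ D) :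
    ‖q z₀‖ ≤ 1 := by
  by_contra! hlt
  set M := (1 + ‖q z₀‖) / 2
  have hM : 1 < M := by simp only [M]; linarith
  have hMz : M < ‖q z₀‖ := by simp only [M]; linarith
  have hfr' : ∀ p ∈ frontier D, ∀ᶠ z in 𝓝[D] p, ‖q z‖ < M := fun p hp => by
    filter_upwards [hfr p hp ((M - 1) / 2) (by linarith)] with z hz
    linarith
  -- By the frontier bound K stays away from ∂D and is compact, so |q| attains its maximum over D
  -- inside D. It is then constant, contradicting the bound near ∂D.
  set K := {z | z ∈ D ∧ M ≤ ‖q z‖}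
  have hK : IsClosed K := by
    refine isClosed_of_closure_subset fun p hp => ?_
    have hfreq : ∃ᶠ z in 𝓝 p, z ∈ K := mem_closure_iff_frequently.1 hp
    have hpD : p ∈ D := by
      by_contra hpD
      have hpf : p ∈ frontier D := by
        rw [ho.frontier_eq]
        exact ⟨closure_mono (fun z hz => hz.1) hp, hpD⟩
      refine hfreq ?_
      filter_upwards [eventually_nhdsWithin_iff.1 (hfr' p hpf)] with z hz hzK
      exact absurd (hz hzK.1) (not_lt.2 hzK.2)
    refine ⟨hpD, ?_⟩
    by_contra! hp'
    have hcont := (hq.continuousOn.continuousAt (ho.mem_nhds hpD)).norm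
    refine hfreq ?_
    filter_upwards [hcont.eventually_lt_const hp'] with z hz hzK
    exact absurd hz (not_lt.2 hzK.2)
  have hKc : IsCompact K :=
    Metric.isCompact_of_isClosed_isBounded hK (hb.subset fun z hz => hz.1)
  obtain ⟨w, hw, hmax⟩ := hKc.exists_isMaxOn ⟨z₀, hz₀, hMz.le⟩
    ((hq.continuousOn.mono fun z hz => hz.1).norm)
  have hmaxD : IsMaxOn (norm ∘ q) D w := fun z hz => by
    by_cases hzK : M ≤ ‖q z‖
    · exact hmax ⟨hz, hzK⟩
    · exact (not_le.1 hzK).le.trans hw.2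
  have hconst := Complex.norm_eqOn_of_isPreconnected_of_isMaxOn hc ho hq hw.1 hmaxD
  have hne : D ≠ univ := fun h => NormedSpace.unbounded_univ ℂ ℂ (h ▸ hb)
  obtain ⟨p, hp⟩ := nonempty_frontier_iff.2 ⟨⟨z₀, hz₀⟩, hne⟩
  have : (𝓝[D] p).NeBot := mem_closure_iff_nhdsWithin_neBot.1 (frontier_subset_closure hp)
  obtain ⟨z, hz, hzD⟩ := ((hfr' p hp).and self_mem_nhdsWithin).exists
  have h1 := hconst hzD
  simp only [Function.comp_apply, Function.const_apply] at h1
  rw [h1] at hz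
  exact absurd hz (not_lt.2 hw.2)

theorem deriv_mul_deriv_eq_one {f g : ℂ → ℂ} {z : ℂ} (hf : DifferentiableAt ℂ f z)
    (hg : DifferentiableAt ℂ g (f z)) (hgf : ∀ᶠ w in 𝓝 z, g (f w) = w) :
    deriv g (f z) * deriv f z = 1 := by
  have h1 := hg.hasDerivAt.comp z hf.hasDerivAt
  have h2 : HasDerivAt (g ∘ f) 1 z := (hasDerivAt_id z).congr_of_eventuallyEq hgf
  exact h1.unique h2

theorem dslope_zero_eq_div {f : ℂ → ℂ} (h0 : f 0 = 0) {z : ℂ} (hz : z ≠ 0) :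
    dslope f 0 z = f z / z := by
  rw [dslope_of_ne _ hz, slope_def_field, h0, sub_zero, sub_zero]

theorem zero_notMem_hypNhd {B : Set ℂ} (hB : B ⊆ {z : ℂ | 1 / 2 < ‖z‖ ∧ ‖z‖ < 1})
    (ho : IsOpen (disc \ B)) : 0 ∉ hypNhd B := fun h => by
  obtain ⟨-, b, hb, hnear⟩ :=
    (mem_hypNhd_iff (fun b hb => mem_ball_zero_iff.2 (hB hb).2) ho).1 h
  have := hnear.le_norm (hB hb).1 (hB hb).2
  rw [norm_zero] at this
  norm_num at this

/-- The comparison of the conformal radii of `U` and of the component `D` of `0` in the complement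
of the hyperbolic neighbourhood. -/
theorem norm_deriv_pow_le {B D : Set ℂ} {φ ψ : ℂ → ℂ}
    (hB : B ⊆ {z : ℂ | 1 / 2 < ‖z‖ ∧ ‖z‖ < 1}) (ho : IsOpen (disc \ B)) (hDo : IsOpen D)
    (hDc : IsPreconnected D) (hD0 : 0 ∈ D) (hD : D ⊆ disc \ hypNhd B)
    (hfr : frontier D ⊆ hypNhd B ∪ {z | 1 ≤ ‖z‖})
    (hφ : IsConformalFromDisc φ (disc \ B) 0) (hψ : IsConformalFromDisc ψ D 0) :
    0 < ‖deriv φ 0‖ ∧ ‖deriv φ 0‖ ^ (75000 + 1) ≤ ‖deriv ψ 0‖ := by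
  have hBd : B ⊆ disc := fun b hb => mem_ball_zero_iff.2 (hB hb).2
  obtain ⟨dφ, bφ, ⟨f, df, hlf, hrf⟩, φ0⟩ := hφ
  obtain ⟨dψ, bψ, ⟨g, dg, hlg, hrg⟩, ψ0⟩ := hψ
  have mem0 : (0 : ℂ) ∈ disc := by simp
  have hdisc : disc ∈ 𝓝 (0 : ℂ) := isOpen_ball.mem_nhds mem0
  have hBN : B ⊆ hypNhd B := fun b hb => (mem_hypNhd_iff hBd ho).2 ⟨hBd hb, b, hb, hypNear_self⟩
  have hDU : D ⊆ disc \ B := fun z hz => ⟨(hD hz).1, fun h => (hD hz).2 (hBN h)⟩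
  have hfm : MapsTo f (disc \ B) disc := fun w hw => by
    obtain ⟨x, hx, rfl⟩ := bφ.surjOn hw
    rwa [hlf hx]
  have hgm : MapsTo g D disc := fun w hw => by
    obtain ⟨x, hx, rfl⟩ := bψ.surjOn hw
    rwa [hlg hx]
  have f0 : f 0 = 0 := by rw [← φ0, hlf mem0, φ0]
  have g0 : g 0 = 0 := by rw [← ψ0, hlg mem0, ψ0]
  have hdφ : deriv f (φ 0) * deriv φ 0 = 1 := deriv_mul_deriv_eq_one
    (dφ.differentiableAt hdisc) (by rw [φ0]; exact df.differentiableAt (ho.mem_nhds (hDU hD0)))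
    (by filter_upwards [hdisc] with w hw using hlf hw)
  have hdψ : deriv g (ψ 0) * deriv ψ 0 = 1 := deriv_mul_deriv_eq_one
    (dψ.differentiableAt hdisc) (by rw [ψ0]; exact dg.differentiableAt (hDo.mem_nhds hD0))
    (by filter_upwards [hdisc] with w hw using hlg hw)
  rw [ψ0] at hdψ
  have hφd : MapsTo φ disc disc := fun w hw => (bφ.mapsTo hw).1
  set H := dslope φ 0
  have dH : DifferentiableOn ℂ H disc := (Complex.differentiableOn_dslope hdisc).2 dφ
  have hH1 : ∀ w ∈ disc, ‖H w‖ ≤ 1 := fun w hw => by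
    have := Complex.norm_dslope_le_div_of_mapsTo_ball dφ (R₂ := 1)
      (by rw [φ0]; exact hφd.mono_right ball_subset_closedBall) hw
    simpa using this
  -- Off 0 this is (g(z)/z)(z/f(z))^75001; the divided slopes remove the singularity and give
  -- |g'(0)| |φ'(0)|^75001 at 0.
  let q : ℂ → ℂ := fun z => dslope g 0 z * H (f z) ^ (75000 + 1)
  have dHf : DifferentiableOn ℂ (fun z => H (f z)) (disc \ B) := dH.comp df hfm
  have dq : DifferentiableOn ℂ q D :=
    ((Complex.differentiableOn_dslope (hDo.mem_nhds hD0)).2 dg).mul ((dHf.mono hDU).pow _)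
  have hqle : ∀ z ∈ D, z ≠ 0 → ‖q z‖ ≤ ‖H (f z)‖ ^ (75000 + 1) / ‖z‖ := fun z hz hz0 => by
    have hg1 : ‖g z‖ ≤ 1 := (mem_ball_zero_iff.1 (hgm hz)).le
    have : ‖q z‖ = ‖g z‖ / ‖z‖ * ‖H (f z)‖ ^ (75000 + 1) := by
      simp only [q, norm_mul, norm_pow, dslope_zero_eq_div g0 hz0, norm_div]
    rw [this, div_mul_eq_mul_div]
    gcongr
    exact mul_le_of_le_one_left (by positivity) hg1
  have hfrq : ∀ p ∈ frontier D, ∀ ε > 0, ∀ᶠ z in 𝓝[D] p, ‖q z‖ ≤ 1 + ε := by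
    intro p hp ε hε
    have hpD : p ∉ D := by
      rw [hDo.frontier_eq] at hp
      exact hp.2
    have hp0 : p ≠ 0 := fun h => hpD (h ▸ hD0)
    have hne : ∀ᶠ z in 𝓝[D] p, z ≠ 0 :=
      (continuousAt_id.eventually_ne hp0).filter_mono nhdsWithin_le_nhds
    by_cases hp1 : 1 ≤ ‖p‖
    · have hcont : ContinuousAt (fun z : ℂ => 1 / ‖z‖) p :=
        continuousAt_const.div continuous_norm.continuousAt (norm_ne_zero_iff.2 hp0)
      have hle : 1 / ‖p‖ < 1 + ε := ((div_le_one (by linarith)).2 hp1).trans_lt (by linarith)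
      filter_upwards [hne, self_mem_nhdsWithin,
        (hcont.eventually_lt_const hle).filter_mono nhdsWithin_le_nhds] with z hz0 hz hzε
      refine (hqle z hz hz0).trans (le_trans ?_ hzε.le)
      gcongr
      exact pow_le_one₀ (norm_nonneg _) (hH1 _ (hfm (hDU hz)))
    · have hpN : p ∈ hypNhd B := (hfr hp).resolve_right hp1
      obtain ⟨hpd, b, hb, hnear⟩ := (mem_hypNhd_iff hBd ho).1 hpN
      -- A whole neighbourhood of a point of B lies in N(B), which D avoids. Hence f is holomorphic
      -- at p and the interior estimate applies there.
      have hpB : p ∉ B := fun hpB => by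
        have hs : 0 < Real.sinh (1 / 2) ^ 2 * ((1 - ‖p‖ ^ 2) * (1 - ‖p‖ ^ 2)) := by
          have h1 := one_sub_norm_sq_pos (mem_ball_zero_iff.1 hpd)
          have h2 := sinh_half_pos
          positivity
        have hev : ∀ᶠ z in 𝓝 p, HypNear z p := by
          have hc : ContinuousAt (fun z : ℂ => Real.sinh (1 / 2) ^ 2 *
              ((1 - ‖z‖ ^ 2) * (1 - ‖p‖ ^ 2)) - ‖z - p‖ ^ 2) p := by fun_prop
          filter_upwards [hc.tendsto.eventually_const_lt (u := 0) (by
            rw [sub_self, norm_zero, zero_pow two_ne_zero, sub_zero]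
            exact hs)] with z hz
          exact (sub_pos.1 hz).le
        obtain ⟨z, hz, hzD⟩ := mem_closure_iff_nhds.1 (frontier_subset_closure hp) _ hev
        exact (hD hzD).2 ((mem_hypNhd_iff hBd ho).2 ⟨(hD hzD).1, p, hpB, hz⟩)
      have hpU : p ∈ disc \ B := ⟨hpd, hpB⟩
      have hφf : φ (f p) = p := hrf hpU
      have hfp : f p ≠ 0 := fun h => hp0 (by rw [← hφf, h, φ0])
      have hval : ‖H (f p)‖ ^ (75000 + 1) / ‖p‖ ≤ 1 := by
        rw [div_le_one (norm_pos_iff.2 hp0), show H (f p) = φ (f p) / f p from dslope_zero_eq_div φ0 hfp,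
          norm_div]
        have := norm_div_pow_le (b := b) dφ hφd φ0 (hB hb).1 (hB hb).2
          (fun w hw h => (bφ.mapsTo hw).2 (h ▸ hb)) (hfm hpU) (by rwa [hφf])
        rwa [hφf] at this ⊢
      have hcont : ContinuousAt (fun z : ℂ => ‖H (f z)‖ ^ (75000 + 1) / ‖z‖) p :=
        (((dHf.continuousOn.continuousAt (ho.mem_nhds hpU)).norm).pow _).div
          continuous_norm.continuousAt (norm_ne_zero_iff.2 hp0)
      filter_upwards [hne, self_mem_nhdsWithin,
        (hcont.eventually_lt_const (hval.trans_lt (by linarith : 1 < 1 + ε))).filter_mono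
          nhdsWithin_le_nhds] with z hz0 hz hzε
      exact (hqle z hz hz0).trans hzε.le
  have hbd : Bornology.IsBounded D := isBounded_ball.subset fun z hz => (hD hz).1
  have hq0 := norm_le_one_of_frontier hDo hDc hbd dq hfrq hD0
  have hval : ‖q 0‖ = ‖deriv g 0‖ * ‖deriv φ 0‖ ^ (75000 + 1) := by
    simp only [q, H, f0, dslope_same, norm_mul, norm_pow]
  rw [hval] at hq0
  refine ⟨norm_pos_iff.2 (right_ne_zero_of_mul_eq_one hdφ), ?_⟩
  have h1 : ‖deriv g 0‖ * ‖deriv ψ 0‖ = 1 := by rw [← norm_mul, hdψ, norm_one]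
  have h2 : 0 < ‖deriv g 0‖ := norm_pos_iff.2 (left_ne_zero_of_mul_eq_one hdψ)
  rw [← h1] at hq0
  exact le_of_mul_le_mul_left hq0 h2

/-! ### Assembly of the theorem. -/

theorem exists_dcap_filledHypNhd_le :
    ∃ C : ℝ, 0 < C ∧ ∀ B : Set ℂ,
      B ⊆ {z : ℂ | 1 / 2 < ‖z‖ ∧ ‖z‖ < 1} →
      IsSimplyConnectedRegion (disc \ B) →
        (0 ∈ disc \ filledHypNhd B ∧
          IsSimplyConnectedRegion
            (disc \ filledHypNhd B)) ∧
        dcap (filledHypNhd B) ≤ C * dcap B := by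
  refine ⟨75000 + 1, by norm_num, fun B hB hU => ?_⟩
  have hBd : B ⊆ disc := fun b hb => mem_ball_zero_iff.2 (hB hb).2
  have h0N := zero_notMem_hypNhd hB hU.1
  have hUd : disc \ B ⊆ disc := Set.sdiff_subset
  have hEcl := isClosed_hypNhd_union hBd hU.1
  have hEc := isPreconnected_hypNhd_union hBd hU.1
    (isPreconnected_compl_of_hasContLog hU.1 hUd hU.hasContLog)
  have hEb : ¬ Bornology.IsBounded (hypNhd B ∪ {z : ℂ | 1 ≤ ‖z‖}) := fun h =>
    not_isBounded_le_norm 1 (h.subset Set.subset_union_right)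
  have h0E : (0 : ℂ) ∈ (hypNhd B ∪ {z : ℂ | 1 ≤ ‖z‖})ᶜ := by
    rintro (h | h)
    · exact h0N h
    · simp only [Set.mem_ofPred_eq, norm_zero] at h
      linarith
  have hcomp := disc_diff_filledHypNhd h0N
  have h0 : (0 : ℂ) ∈ disc \ filledHypNhd B := hcomp ▸ mem_connectedComponentIn h0E
  have hDo : IsOpen (disc \ filledHypNhd B) := hcomp ▸ hEcl.isOpen_compl.connectedComponentIn
  have hDc : IsPreconnected (disc \ filledHypNhd B) :=
    hcomp ▸ isPreconnected_connectedComponentIn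
  have hDN : disc \ filledHypNhd B ⊆ disc \ hypNhd B :=
    Set.sdiff_subset_sdiff_right Set.subset_union_left
  have hlog : HasContLog (disc \ filledHypNhd B) :=
    hasContLog_of_not_isBounded_components hDo ⟨⟨0, h0⟩, hDc⟩ fun K hK _ z hz => by
      rw [hcomp] at hK hz
      exact not_isBounded_connectedComponentIn hEcl hEc hEb hK hz
  obtain ⟨ψ, hψ⟩ := exists_isConformalFromDisc hDo hDc h0 Set.sdiff_subset hlog
  obtain ⟨φ, hφ⟩ := exists_isConformalFromDisc hU.1 hU.2.isPathConnected.isConnected.isPreconnected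
    ⟨by simp, fun h => h0N ((mem_hypNhd_iff hBd hU.1).2
      ⟨by simp, 0, h, hypNear_self⟩)⟩ hUd hU.hasContLog
  refine ⟨⟨h0, hψ.isSimplyConnectedRegion hDo⟩, ?_⟩
  obtain ⟨hpos, hle⟩ := norm_deriv_pow_le hB hU.1 hDo hDc h0 hDN
    (hcomp ▸ frontier_connectedComponentIn_subset hEcl 0) hφ hψ
  -- Taking logarithms turns the exponent 75001 of the conformal radius into the constant C.
  have hlogle := Real.log_le_log (pow_pos hpos _) hle
  rw [Real.log_pow] at hlogle
  push_cast at hlogle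
  rw [dcap, dcap, crad_eq hφ, crad_eq hψ]
  linarith

end DiscCapacity

theorem proposition2 :
    ∃ C : ℝ, 0 < C ∧ ∀ B : Set ℂ,
      B ⊆ {z : ℂ | 1 / 2 < ‖z‖ ∧ ‖z‖ < 1} →
      DiscCapacity.IsSimplyConnectedRegion (DiscCapacity.disc \ B) →
        (0 ∈ DiscCapacity.disc \ DiscCapacity.filledHypNhd B ∧
          DiscCapacity.IsSimplyConnectedRegion
            (DiscCapacity.disc \ DiscCapacity.filledHypNhd B)) ∧
        DiscCapacity.dcap (DiscCapacity.filledHypNhd B) ≤ C * DiscCapacity.dcap B :=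
  DiscCapacity.exists_dcap_filledHypNhd_le
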